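/- **Setting.** Let $X$ be a real reflexive Banach space with a topological direct sum decomposition $X=X^+\oplus X^-$, $u=u^++u^-$, where $X^+$ is a Hilbert space with scalar product $\langle\cdot,\cdot\rangle$, $\langle u,u\rangle=\|u\|^2$ for $u\in X^+$, and $\|u\|^2=\|u^+\|^2+\|u^-\|^2$ for $u\in X$. Write $u_n\xrightarrow{\mathcal T}u$ if $u_n^+\to u^+$ in norm and $u_n^-\rightharpoonup u^-$ weakly. Let $J(u)=\frac12\|u^+\|^2-I(u)$ and $\mathcal M=\{u\in X: I'(u)|_{X^-}=0\}$, and assume: * (I1) $I\in C^1(X,\mathbb R)$ and $I(u)\ge I(0)=0$ for all $u\in X$. * (I2) If $u_n\xrightarrow{\mathcal T}u$, then $\liminf_n I(u_n)\ge I(u)$. * (I3) If $u_n\xrightarrow{\mathcal T}u$ and $I(u_n)\to I(u)$, then $u_n\to u$. * (I4) $\|u^+\|+I(u)\to\infty$ as $\|u\|\to\infty$. * (I5) If $u\in\mathcal M$, then $I(u)<I(u+v)$ for every $v\in X^-\setminus\{0\}$. * (I6) There is $r>0$ such that $\inf\{J(u): u\in X^+,\ \|u\|=r\}>0$. * (I7)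 $I(t_nu_n)/t_n^2\to\infty$ whenever $t_n\to\infty$ and $u_n^+\to u^+\neq0$ with $u^+\in X^+$. Then, for every $u\in X^+$, $J|_{u+X^-}$ has a unique global maximizer $m(u)$, and $\widetilde J:=J\circ m:X^+\to\mathbb R$ is of class $C^1$. Let $\mathcal K=\{u\in X^+:\widetilde J'(u)=0\}$. Let $G$ be a topological group acting on $X$ by isometries such that for each $u\ne0$ the set $(G*u)\setminus\{u\}$ is bounded away from $u$, where $G*u=\{gu: g\in G\}$; suppose that $J$ is $G$-invariant, and that $gX^\pm\subset X^\pm$ for all $g\in G$. A *critical orbit* is a set $G*u$ with $u\in\mathcal K$. For $\alpha\le\beta$ call $(u_n)\subset X^+$ a *Cerami sequence between $\alpha$ and $\beta$* if $\alpha\le\liminf_n\widetilde J(u_n)\le\limsup_n\widetilde J(u_n)\le\beta$ and $(1+\|u_n\|)\widetilde J'(u_n)\to0$ in $(X^+)^*$. Condition $(M)_\alpha^\beta$ says that: * (a) there is a constant $M_\alpha^\beta$ such that $\limsup_n\|u_n\|\le M_\alpha^\beta$ for every Cerami sequence $(u_n)$ between $\alpha$ and $\beta$; * (b) if the number of critical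 orbits in $\{u\in X^+:\alpha\le\widetilde J(u)\le\beta\}$ is finite, then there is $m_\alpha^\beta>0$ such that $\liminf_n\|u_n-v_n\|=0$ for any two Cerami sequences $(u_n),(v_n)$ between $\alpha$ and $\beta$ with $\|u_n-v_n\|<m_\alpha^\beta$ for all large $n$. **Theorem 3.2.** In this setting, suppose that $J$ is even, $\dim X^+=\infty$, $\widetilde J(u)\ge0$ for every $u\in\mathcal K$, and $(M)_0^\beta$ holds for every $\beta>0$. Then there are infinitely many distinct critical orbits $G*u$, $u\in\mathcal K$; likewise, the critical points of $J$ in $X$ form infinitely many distinct $G$-orbits. -/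

import Mathlib

open Filter Topology

noncomputable section

/-- `X` is reflexive: the canonical map into the bidual is onto. -/
def IsReflexiveSpace (X : Type*) [NormedAddCommGroup X] [NormedSpace ℝ X] : Prop :=
  Function.Surjective (NormedSpace.inclusionInDoubleDual ℝ X)

/-- A direct sum decomposition `X = X⁺ ⊕ X⁻` such that the norm of `X⁺` comes from a scalar
product and `‖u‖² = ‖u⁺‖² + ‖u⁻‖²`. The last identity makes both projections continuous, so that
the sum is topological, both summands are closed and, if `X` is complete, `X⁺` is a Hilbert
space. -/
structure HilbertSplitting (X : Type*) [NormedAddCommGroup X] [NormedSpace ℝ X] where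
  /-- the summand `X⁺` -/
  pos : Submodule ℝ X
  /-- the summand `X⁻` -/
  neg : Submodule ℝ X
  isCompl : IsCompl pos neg
  /-- the scalar product of `X⁺` -/
  scalar : pos →ₗ[ℝ] pos →ₗ[ℝ] ℝ
  scalar_comm : ∀ u v : pos, scalar u v = scalar v u
  scalar_self : ∀ u : pos, scalar u u = ‖u‖ ^ 2
  norm_sq : ∀ (u : pos) (v : neg), ‖(u : X) + (v : X)‖ ^ 2 = ‖u‖ ^ 2 + ‖v‖ ^ 2

namespace HilbertSplitting

variable {X : Type*} [NormedAddCommGroup X] [NormedSpace ℝ X]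

/-- `u⁺` -/
def plus (D : HilbertSplitting X) (u : X) : D.pos := D.pos.projectionOnto D.neg D.isCompl u

/-- `u⁻` -/
def minus (D : HilbertSplitting X) (u : X) : D.neg :=
  D.neg.projectionOnto D.pos D.isCompl.symm u

/-- `J(u) = ½‖u⁺‖² - I(u)` -/
def J (D : HilbertSplitting X) (I : X → ℝ) (u : X) : ℝ := 1 / 2 * ‖D.plus u‖ ^ 2 - I u

/-- Sequential convergence in the topology `𝒯`: norm convergence of `u_n⁺` in `X⁺` and weak
convergence of `u_n⁻` in `X⁻`. -/
def TConverges (D : HilbertSplitting X) (u : ℕ → X) (w : X) : Prop :=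
  Tendsto (fun n => D.plus (u n)) atTop (𝓝 (D.plus w)) ∧
    ∀ f : StrongDual ℝ D.neg, Tendsto (fun n => f (D.minus (u n))) atTop (𝓝 (f (D.minus w)))

/-- The constraint `ℳ = {u : I'(u)|_{X⁻} = 0}`. -/
def M (D : HilbertSplitting X) (I : X → ℝ) : Set X :=
  {u | ∀ v : D.neg, fderiv ℝ I u (v : X) = 0}

def I1 (_D : HilbertSplitting X) (I : X → ℝ) : Prop :=
  ContDiff ℝ 1 I ∧ I 0 = 0 ∧ ∀ u, 0 ≤ I u

def I2 (D : HilbertSplitting X) (I : X → ℝ) : Prop :=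
  ∀ (u : ℕ → X) (w : X), D.TConverges u w →
    ((I w : ℝ) : EReal) ≤ liminf (fun n => ((I (u n) : ℝ) : EReal)) atTop

def I3 (D : HilbertSplitting X) (I : X → ℝ) : Prop :=
  ∀ (u : ℕ → X) (w : X), D.TConverges u w → Tendsto (fun n => I (u n)) atTop (𝓝 (I w)) →
    Tendsto u atTop (𝓝 w)

def I4 (D : HilbertSplitting X) (I : X → ℝ) : Prop :=
  Tendsto (fun u : X => ‖D.plus u‖ + I u) (comap (fun u : X => ‖u‖) atTop) atTop

def I5 (D : HilbertSplitting X) (I : X → ℝ) : Prop :=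
  ∀ u ∈ D.M I, ∀ v : D.neg, v ≠ 0 → I u < I (u + (v : X))

/-- There is `r > 0` such that the infimum of `J` over `{u ∈ X⁺ : ‖u‖ = r}` is positive, that is,
`J` has a positive lower bound `a` there. -/
def I6 (D : HilbertSplitting X) (I : X → ℝ) : Prop :=
  ∃ r > (0 : ℝ), ∃ a > (0 : ℝ), ∀ u : D.pos, ‖u‖ = r → a ≤ D.J I (u : X)

def I7 (D : HilbertSplitting X) (I : X → ℝ) : Prop :=
  ∀ (t : ℕ → ℝ) (u : ℕ → X) (w : D.pos), Tendsto t atTop atTop →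
    Tendsto (fun n => D.plus (u n)) atTop (𝓝 w) → w ≠ 0 →
    Tendsto (fun n => I (t n • u n) / t n ^ 2) atTop atTop

/-- `w` is a global maximizer of `J` on the affine subspace `u + X⁻`. -/
def IsFiberMax (D : HilbertSplitting X) (I : X → ℝ) (u : D.pos) (w : X) : Prop :=
  D.plus w = u ∧ ∀ w' : X, D.plus w' = u → D.J I w' ≤ D.J I w

/-- `m(u)`, the global maximizer of `J` on `u + X⁻`. Under `I1`–`I5` it exists, is unique, and is
the only element of `ℳ` in `u + X⁻`. -/
def m (D : HilbertSplitting X) (I : X → ℝ) (u : D.pos) : X :=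
  Classical.epsilon (D.IsFiberMax I u)

/-- The reduced functional `J̃ = J ∘ m` on `X⁺`; it is of class `C¹` under `I1`–`I5`. -/
def Jt (D : HilbertSplitting X) (I : X → ℝ) (u : D.pos) : ℝ := D.J I (D.m I u)

/-- The critical set `𝒦 = {u ∈ X⁺ : J̃'(u) = 0}`. -/
def K (D : HilbertSplitting X) (I : X → ℝ) : Set D.pos :=
  {u | HasFDerivAt (D.Jt I) (0 : D.pos →L[ℝ] ℝ) u}

section Action

variable (G : Type*) [Group G] [MulAction G X]

/-- `G` acts by isometries, discretely (for `u ≠ 0` the set `(G*u) \ {u}` is bounded away from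
`u`), leaves `J` invariant, and maps each of `X⁺`, `X⁻` into itself. -/
structure IsAdmissibleAction (D : HilbertSplitting X) (I : X → ℝ) : Prop where
  isometry : ∀ g : G, Isometry (fun u : X => g • u)
  discrete : ∀ u : X, u ≠ 0 →
    ∃ ε > (0 : ℝ), ∀ w ∈ MulAction.orbit G u, w ≠ u → ε ≤ ‖w - u‖
  invariant : ∀ (g : G) (u : X), D.J I (g • u) = D.J I u
  pos_invariant : ∀ (g : G), ∀ u ∈ D.pos, g • u ∈ D.pos
  neg_invariant : ∀ (g : G), ∀ u ∈ D.neg, g • u ∈ D.neg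

/-- The critical orbits `G*u`, `u ∈ 𝒦`. -/
def criticalOrbits (D : HilbertSplitting X) (I : X → ℝ) : Set (Set X) :=
  {O | ∃ u ∈ D.K I, O = MulAction.orbit G (u : X)}

/-- The critical orbits contained in `J̃_α^β = {u ∈ X⁺ : α ≤ J̃(u) ≤ β}`. -/
def criticalOrbitsBetween (D : HilbertSplitting X) (I : X → ℝ) (α β : ℝ) : Set (Set X) :=
  {O | ∃ u ∈ D.K I, α ≤ D.Jt I u ∧ D.Jt I u ≤ β ∧ O = MulAction.orbit G (u : X)}

end Action

/-- `(u_n) ⊂ X⁺` is a Cerami sequence of `J̃` between the levels `α` and `β`: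
`α ≤ liminf J̃(u_n) ≤ limsup J̃(u_n) ≤ β` and `(1 + ‖u_n‖) J̃'(u_n) → 0` in the dual of `X⁺`. -/
def IsCerami (D : HilbertSplitting X) (I : X → ℝ) (α β : ℝ) (u : ℕ → D.pos) : Prop :=
  (α : EReal) ≤ liminf (fun n => ((D.Jt I (u n) : ℝ) : EReal)) atTop ∧
    limsup (fun n => ((D.Jt I (u n) : ℝ) : EReal)) atTop ≤ (β : EReal) ∧
    Tendsto (fun n => (1 + ‖u n‖) • fderiv ℝ (D.Jt I) (u n)) atTop (𝓝 0)

/-- The condition `(M)_α^β`, for `α ≤ β`. -/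
structure ConditionM (G : Type*) [Group G] [MulAction G X]
    (D : HilbertSplitting X) (I : X → ℝ) (α β : ℝ) : Prop where
  bounded : ∃ C : ℝ, ∀ u : ℕ → D.pos, D.IsCerami I α β u →
    limsup (fun n => ((‖u n‖ : ℝ) : EReal)) atTop ≤ (C : EReal)
  discrete : (D.criticalOrbitsBetween G I α β).Finite →
    ∃ δ > (0 : ℝ), ∀ u v : ℕ → D.pos, D.IsCerami I α β u → D.IsCerami I α β v →
      (∀ᶠ n in atTop, ‖u n - v n‖ < δ) →
      liminf (fun n => ((‖u n - v n‖ : ℝ) : EReal)) atTop = 0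

end HilbertSplitting

end

/-!
The functional `J̃ = J ∘ m` is an even `C¹` functional on the Hilbert space `X⁺`, with
`J̃ 0 = 0`, positive on a sphere and negative far out in every finite-dimensional subspace
(`HilbertSplitting.Reducible.contDiff_Jt`, `HilbertSplitting.Reducible.exists_Jt_neg`). So it has
the geometry of the symmetric mountain pass theorem, and the proof is by contradiction: finitely
many critical orbits give finitely many critical values, and, since the orbits are uniformly
discrete and `G` acts by isometries, a critical set whose points are uniformly separated
(`HilbertSplitting.infinite_criticalOrbits`). That this is impossible is
`false_of_finite_critical_values`, whose argument is the following.

Let `η` be the flow of a bounded, odd, globally Lipschitz field along which `J̃` decreases, strictly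
so outside a small neighbourhood of the critical set (`exists_lipschitz_pseudogradient`,
`exists_descent_flow`). Part (a) of the condition `(M)` keeps trajectories of bounded nonnegative
energy bounded; part (b) makes every displacement cost a definite amount of energy
(`exists_uniform_drop`), so that such trajectories converge (`exists_tendsto_of_drop`), with limits
close to critical points. If `p` is the number of critical values, take a subspace of dimension
`p + 1` and in it the open symmetric set `A` of those points that flow into the part of
`{J̃ < a}` inside the sphere on which `J̃ ≥ a`. It is bounded, and points on its frontier never
leave `{a ≤ J̃}` (`le_of_mem_frontier_basin`). Each of them thus has a limiting critical point: the
value of `J̃` there is one of `p` levels, and, as it is not `0`, the critical point can be given a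
sign that is odd under `u ↦ -u`. On the points of the highest level this sign is locally constant,
hence extends to an odd continuous function; removing a neighbourhood and descending through the
levels gives `p` odd continuous functions without common zero on the frontier of `A`
(`exists_odd_functions`). This contradicts the theorem of Borsuk and Ulam
(`exists_common_zero_on_frontier`).

The Borsuk–Ulam theorem is proved combinatorially. On a fine subdivision of the cube, the boundary
of the discretized set `A` is a mod 2 cycle that is invariant under the antipodal map; the sign
changes of the odd functions are cocycles, and evaluating their cup product on half of the cycle
gives an odd number, so that a small simplex carries sign changes of all the functions.
The simplices are lists of vertices.

For the reduction, weak sequential compactness of bounded sequences in a reflexive space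
(`IsReflexiveSpace.exists_weak_subseq`) yields existence and continuity of the maximizer `m`,
and a maximizer depending continuously on the parameter makes `J̃` continuously differentiable,
with derivative the restriction of `J'(m(u))`. Hence `m(u)` is a critical point of `J` whenever
`u ∈ 𝒦`, and as the projection onto `X⁺` commutes with the action, different orbits in `𝒦` come
from different orbits of critical points of `J`.
-/

noncomputable section

/-! ### Mod 2 chains of vertex lists -/

/-- Mod 2 chains whose simplices are lists of vertices; the empty list is the augmentation cell. -/
abbrev ListChain (V : Type*) := List V →₀ ZMod 2

namespace ListChain

variable {V : Type*}

/-- The boundary of a single list: the sum of the lists obtained by deleting one entry. -/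
def boundaryList : List V → ListChain V
  | [] => 0
  | v :: l =>
    Finsupp.single l 1 + Finsupp.lmapDomain (ZMod 2) (ZMod 2) (List.cons v) (boundaryList l)

/-- The (augmented) simplicial boundary operator. -/
def boundary : ListChain V →ₗ[ZMod 2] ListChain V := Finsupp.linearCombination (ZMod 2) boundaryList

/-- The cone with apex `v`. -/
def cone (v : V) : ListChain V →ₗ[ZMod 2] ListChain V :=
  Finsupp.lmapDomain (ZMod 2) (ZMod 2) (List.cons v)

/-- The chain map induced by a map of vertices. -/
def vmap (f : V → V) : ListChain V →ₗ[ZMod 2] ListChain V :=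
  Finsupp.lmapDomain (ZMod 2) (ZMod 2) (List.map f)

/-- The prism over a single list, with bottom face given by `B` and top face given by `T`. -/
def prismList (B T : V → V) : List V → ListChain V
  | [] => 0
  | v :: l => Finsupp.single (B v :: T v :: l.map T) 1 + cone (B v) (prismList B T l)

/-- The prism operator, a chain homotopy between `vmap B` and `vmap T`. -/
def prism (B T : V → V) : ListChain V →ₗ[ZMod 2] ListChain V :=
  Finsupp.linearCombination (ZMod 2) (prismList B T)

open Classical in
/-- The projection of a chain to its simplices having at least one vertex in `A`. -/
def meeting (A : Set V) : ListChain V →ₗ[ZMod 2] ListChain V :=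
  Finsupp.linearCombination (ZMod 2) fun l => if ∃ v ∈ l, v ∈ A then Finsupp.single l 1 else 0

@[simp] lemma cone_single (v : V) (l : List V) :
    cone v (Finsupp.single l 1) = Finsupp.single (v :: l) 1 := by simp [cone]

@[simp] lemma vmap_single (f : V → V) (l : List V) :
    vmap f (Finsupp.single l 1) = Finsupp.single (l.map f) 1 := by simp [vmap]

@[simp] lemma boundary_nil : boundary (Finsupp.single ([] : List V) 1) = 0 := by
  simp [boundary, boundaryList]

lemma boundary_cons (v : V) (l : List V) :
    boundary (Finsupp.single (v :: l) 1)
      = Finsupp.single l 1 + cone v (boundary (Finsupp.single l 1)) := by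
  simp [boundary, boundaryList, cone]

@[simp] lemma prism_nil (B T : V → V) : prism B T (Finsupp.single ([] : List V) 1) = 0 := by
  simp [prism, prismList]

lemma prism_cons (B T : V → V) (v : V) (l : List V) :
    prism B T (Finsupp.single (v :: l) 1)
      = Finsupp.single (B v :: T v :: l.map T) 1 + cone (B v) (prism B T (Finsupp.single l 1)) := by
  simp [prism, prismList]

lemma meeting_single_of_exists {A : Set V} {l : List V} (h : ∃ v ∈ l, v ∈ A) :
    meeting A (Finsupp.single l 1) = Finsupp.single l 1 := by
  simp only [meeting, Finsupp.linearCombination_single, if_pos h, one_smul]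

lemma meeting_single_of_forall {A : Set V} {l : List V} (h : ∀ v ∈ l, v ∉ A) :
    meeting A (Finsupp.single l 1) = 0 := by
  have h' : ¬ ∃ v ∈ l, v ∈ A := by push Not; exact h
  simp only [meeting, Finsupp.linearCombination_single, if_neg h', smul_zero]

/-- Two linear maps on chains agree if they agree on single lists. -/
lemma hom_ext {M : Type*} [AddCommMonoid M] [Module (ZMod 2) M] {f g : ListChain V →ₗ[ZMod 2] M}
    (h : ∀ l, f (Finsupp.single l 1) = g (Finsupp.single l 1)) : f = g :=
  Finsupp.lhom_ext' fun l => LinearMap.ext_ring (h l)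

lemma boundary_cone (v : V) (c : ListChain V) :
    boundary (cone v c) = c + cone v (boundary c) := by
  have : boundary ∘ₗ cone v = LinearMap.id + cone v ∘ₗ boundary :=
    hom_ext fun l => by simp [boundary_cons]
  exact LinearMap.congr_fun this c

lemma boundary_boundary (c : ListChain V) : boundary (boundary c) = 0 := by
  have : (boundary ∘ₗ boundary : ListChain V →ₗ[ZMod 2] ListChain V) = 0 := by
    refine hom_ext fun l => ?_
    induction l with
    | nil => simp
    | cons v l ih =>
      simp only [LinearMap.comp_apply, LinearMap.zero_apply] at ih ⊢
      rw [boundary_cons, map_add, boundary_cone, ih, map_zero, add_zero, ZModModule.add_self]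
  exact LinearMap.congr_fun this c

lemma vmap_cone (f : V → V) (v : V) (c : ListChain V) :
    vmap f (cone v c) = cone (f v) (vmap f c) := by
  have : vmap f ∘ₗ cone v = cone (f v) ∘ₗ vmap f := hom_ext fun l => by simp
  exact LinearMap.congr_fun this c

lemma boundary_vmap (f : V → V) (c : ListChain V) : boundary (vmap f c) = vmap f (boundary c) := by
  have : boundary ∘ₗ vmap f = vmap f ∘ₗ boundary := by
    refine hom_ext fun l => ?_
    induction l with
    | nil => simp
    | cons v l ih =>
      simp only [LinearMap.comp_apply, vmap_single] at ih ⊢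
      rw [boundary_cons, map_add, vmap_cone, ← ih, List.map_cons, boundary_cons, vmap_single]
  exact LinearMap.congr_fun this c

lemma prism_cone (B T : V → V) (v : V) (c : ListChain V) :
    prism B T (cone v c) = cone (B v) (cone (T v) (vmap T c)) + cone (B v) (prism B T c) := by
  have : prism B T ∘ₗ cone v
      = cone (B v) ∘ₗ cone (T v) ∘ₗ vmap T + cone (B v) ∘ₗ prism B T :=
    hom_ext fun l => by simp [prism_cons]
  exact LinearMap.congr_fun this c

lemma boundary_prism (B T : V → V) (c : ListChain V) :
    boundary (prism B T c) = vmap T c + vmap B c + prism B T (boundary c) := by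
  have : boundary ∘ₗ prism B T = vmap T + vmap B + prism B T ∘ₗ boundary := by
    refine hom_ext fun l => ?_
    induction l with
    | nil =>
      simp [ZModModule.add_self]
    | cons v l ih =>
      simp only [LinearMap.comp_apply, LinearMap.add_apply, vmap_single] at ih ⊢
      simp only [prism_cons, boundary_cons, map_add, boundary_cone, ih, prism_cone, cone_single,
        List.map_cons, ← vmap_single T l, boundary_vmap]
      simp only [vmap_single, cone_single]
      have h := ZModModule.add_self (cone (B v) (Finsupp.single (l.map T) (1 : ZMod 2)))
      simp only [cone_single] at h
      linear_combination (norm := module) h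
  exact LinearMap.congr_fun this c

lemma vmap_meeting {A : Set V} {f : V → V} (hf : ∀ v, f v ∈ A ↔ v ∈ A) (c : ListChain V) :
    vmap f (meeting A c) = meeting A (vmap f c) := by
  have : vmap f ∘ₗ meeting A = meeting A ∘ₗ vmap f := by
    refine hom_ext fun l => ?_
    simp only [LinearMap.comp_apply, vmap_single]
    by_cases h : ∃ v ∈ l, v ∈ A
    · rw [meeting_single_of_exists h, meeting_single_of_exists, vmap_single]
      obtain ⟨v, hv, hA⟩ := h
      exact ⟨f v, List.mem_map_of_mem hv, (hf v).2 hA⟩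
    · push Not at h
      rw [meeting_single_of_forall h, meeting_single_of_forall, map_zero]
      intro v hv
      obtain ⟨w, hw, rfl⟩ := List.mem_map.1 hv
      exact fun h' => h w hw ((hf w).1 h')
  exact LinearMap.congr_fun this c

/-- Chains all of whose simplices satisfy `Q`. -/
abbrev on (Q : List V → Prop) : Submodule (ZMod 2) (ListChain V) :=
  Finsupp.supported (ZMod 2) (ZMod 2) {l | Q l}

lemma single_mem_on {Q : List V → Prop} {l : List V} (h : Q l) :
    Finsupp.single l (1 : ZMod 2) ∈ on Q :=
  Finsupp.single_mem_supported _ _ h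

/-- A linear map sends chains on `Q` into a submodule as soon as it does so for single lists. -/
lemma map_mem_of_on {M : Type*} [AddCommMonoid M] [Module (ZMod 2) M]
    (f : ListChain V →ₗ[ZMod 2] M) {Q : List V → Prop} {S : Submodule (ZMod 2) M}
    (h : ∀ l, Q l → f (Finsupp.single l 1) ∈ S) {c : ListChain V} (hc : c ∈ on Q) : f c ∈ S := by
  have : on Q ≤ S.comap f := by
    rw [on, Finsupp.supported_eq_span_single, Submodule.span_le]
    rintro _ ⟨l, hl, rfl⟩
    exact h l hl
  exact this hc

lemma eq_of_on {M : Type*} [AddCommGroup M] [Module (ZMod 2) M]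
    {f g : ListChain V →ₗ[ZMod 2] M} {Q : List V → Prop}
    (h : ∀ l, Q l → f (Finsupp.single l 1) = g (Finsupp.single l 1)) {c : ListChain V}
    (hc : c ∈ on Q) : f c = g c := by
  have := map_mem_of_on (f - g) (S := ⊥) (fun l hl => by simp [h l hl]) hc
  simpa [sub_eq_zero] using this

lemma on_mono {Q Q' : List V → Prop} (h : ∀ l, Q l → Q' l) : on Q ≤ on Q' :=
  Finsupp.supported_mono fun l hl => h l hl

lemma cone_mem {Q Q' : List V → Prop} {v : V} (h : ∀ l, Q l → Q' (v :: l)) {c : ListChain V}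
    (hc : c ∈ on Q) : cone v c ∈ on Q' :=
  map_mem_of_on _ (fun l hl => by rw [cone_single]; exact single_mem_on (h l hl)) hc

lemma boundary_single_mem (l : List V) :
    boundary (Finsupp.single l 1) ∈ on (fun l' => l' ⊆ l) := by
  induction l with
  | nil => simp
  | cons v l ih =>
    rw [boundary_cons]
    exact add_mem (single_mem_on (Q := fun l' => l' ⊆ v :: l) (List.subset_cons_self v l))
      (cone_mem (Q' := fun l' => l' ⊆ v :: l) (fun l' hl' => List.cons_subset_cons v hl') ih)

lemma prism_single_mem (B T : V → V) (l : List V) :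
    prism B T (Finsupp.single l 1) ∈ on (fun l' => ∀ x ∈ l', ∃ v ∈ l, x = B v ∨ x = T v) := by
  induction l with
  | nil => simp
  | cons v l ih =>
    rw [prism_cons]
    refine add_mem (single_mem_on ?_) (cone_mem ?_ ih)
    · intro x hx
      simp only [List.mem_cons, List.mem_map] at hx ⊢
      rcases hx with rfl | rfl | ⟨w, hw, rfl⟩
      · exact ⟨v, Or.inl rfl, Or.inl rfl⟩
      · exact ⟨v, Or.inl rfl, Or.inr rfl⟩
      · exact ⟨w, Or.inr hw, Or.inr rfl⟩
    · intro l' hl' x hx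
      rcases List.mem_cons.1 hx with rfl | hx
      · exact ⟨v, List.mem_cons_self, Or.inl rfl⟩
      · obtain ⟨w, hw, h⟩ := hl' x hx
        exact ⟨w, List.mem_cons_of_mem _ hw, h⟩

lemma meeting_of_forall {A : Set V} {c : ListChain V} (hc : c ∈ on (fun l => ∀ v ∈ l, v ∉ A)) :
    meeting A c = 0 := by
  simpa using eq_of_on (f := meeting A) (g := 0)
    (fun l hl => by simpa using meeting_single_of_forall hl) hc

lemma meeting_mem (A : Set V) {Q : List V → Prop} {c : ListChain V} (hc : c ∈ on Q) :
    meeting A c ∈ on (fun l => Q l ∧ ∃ v ∈ l, v ∈ A) := by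
  refine map_mem_of_on _ (fun l hl => ?_) hc
  by_cases h : ∃ v ∈ l, v ∈ A
  · rw [meeting_single_of_exists h]; exact single_mem_on ⟨hl, h⟩
  · push Not at h
    rw [meeting_single_of_forall h]; exact zero_mem _

lemma add_meeting_mem (A : Set V) {Q : List V → Prop} {c : ListChain V} (hc : c ∈ on Q) :
    c + meeting A c ∈ on (fun l => Q l ∧ ∀ v ∈ l, v ∉ A) := by
  refine map_mem_of_on (LinearMap.id + meeting A) (fun l hl => ?_) hc
  by_cases h : ∃ v ∈ l, v ∈ A
  · simp [meeting_single_of_exists h, ZModModule.add_self]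
  · push Not at h
    simp only [LinearMap.add_apply, LinearMap.id_apply, meeting_single_of_forall h, add_zero]
    exact single_mem_on ⟨hl, h⟩

/-! ### Cup products of coboundaries -/

/-- The value on a list of the cup product of the coboundaries of the `0`-cochains in `S`. -/
def cupList : List (V → ZMod 2) → List V → ZMod 2
  | [], [_] => 1
  | s :: S, v :: w :: l => (s v + s w) * cupList S (w :: l)
  | _, _ => 0

/-- The value on a list of the cup product of `s` with the coboundaries of the elements of `S`. -/
def primList (s : V → ZMod 2) (S : List (V → ZMod 2)) : List V → ZMod 2
  | [] => 0
  | v :: l => s v * cupList S (v :: l)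

/-- The cup product of the coboundaries of the `0`-cochains in `S`, as a functional. -/
def cup (S : List (V → ZMod 2)) : ListChain V →ₗ[ZMod 2] ZMod 2 :=
  Finsupp.linearCombination (ZMod 2) (cupList S)

/-- The cochain `s ⌣ cup S`, a primitive of `cup (s :: S)`. -/
def prim (s : V → ZMod 2) (S : List (V → ZMod 2)) : ListChain V →ₗ[ZMod 2] ZMod 2 :=
  Finsupp.linearCombination (ZMod 2) (primList s S)

lemma cup_single (S : List (V → ZMod 2)) (l : List V) :
    cup S (Finsupp.single l 1) = cupList S l := by simp [cup]

lemma prim_single (s : V → ZMod 2) (S : List (V → ZMod 2)) (l : List V) :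
    prim s S (Finsupp.single l 1) = primList s S l := by simp [prim]

@[simp] lemma cupList_nil (S : List (V → ZMod 2)) : cupList S [] = 0 := by
  cases S <;> rfl

lemma cup_nil_cone_cone (v w : V) (c : ListChain V) : cup [] (cone v (cone w c)) = 0 := by
  have : cup [] ∘ₗ cone v ∘ₗ cone w = 0 := hom_ext fun l => by simp [cup_single, cupList]
  exact LinearMap.congr_fun this c

lemma cup_cons_cone_cone (s : V → ZMod 2) (S : List (V → ZMod 2)) (v w : V) (c : ListChain V) :
    cup (s :: S) (cone v (cone w c)) = (s v + s w) * cup S (cone w c) := by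
  have : cup (s :: S) ∘ₗ cone v ∘ₗ cone w = (s v + s w) • (cup S ∘ₗ cone w) :=
    hom_ext fun l => by simp [cup_single, cupList]
  exact LinearMap.congr_fun this c

lemma cup_cons_add (s : V → ZMod 2) (S : List (V → ZMod 2)) (v w : V) (l : List V) :
    cupList (s :: S) (w :: l) + cupList (s :: S) (v :: l) = (s v + s w) * cupList S l := by
  cases l with
  | nil => simp [cupList]
  | cons u l =>
    simp only [cupList]
    linear_combination (cupList S (u :: l)) * CharTwo.add_self_eq_zero (s u)

/-- The cup product of coboundaries is a cocycle. -/
lemma cup_boundary (S : List (V → ZMod 2)) (c : ListChain V) : cup S (boundary c) = 0 := by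
  have : cup S ∘ₗ boundary = 0 := by
    refine hom_ext fun l => ?_
    simp only [LinearMap.comp_apply, LinearMap.zero_apply]
    induction S generalizing l with
    | nil =>
      match l with
      | [] => simp
      | [v] => simp [boundary_cons, cup_single]
      | v :: w :: l =>
        simp only [boundary_cons, map_add, cup_nil_cone_cone, cup_single, cone_single, add_zero]
        cases l <;> simp [cupList, CharTwo.add_self_eq_zero]
    | cons s S ih =>
      match l with
      | [] => simp
      | [v] => simp [boundary_cons, cup_single]
      | v :: w :: l =>
        have h := ih (w :: l)
        simp only [boundary_cons, map_add, cup_cons_cone_cone, cup_single, cone_single] at h ⊢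
        rw [← add_assoc, cup_cons_add, ← mul_add, h, mul_zero]
  exact LinearMap.congr_fun this c

/-- `prim s S` is a primitive of `cup (s :: S)`. -/
lemma prim_boundary (s : V → ZMod 2) (S : List (V → ZMod 2)) (c : ListChain V) :
    prim s S (boundary c) = cup (s :: S) c := by
  have : prim s S ∘ₗ boundary = cup (s :: S) := by
    refine hom_ext fun l => ?_
    cases l with
    | nil => simp [cup_single]
    | cons v l =>
      have hcone : ∀ c, prim s S (cone v c) = s v * cup S (cone v c) := fun c => by
        have : prim s S ∘ₗ cone v = s v • (cup S ∘ₗ cone v) :=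
          hom_ext fun l => by simp [cup_single, prim_single, primList]
        exact LinearMap.congr_fun this c
      have h := cup_boundary S (Finsupp.single (v :: l) 1)
      rw [boundary_cons, map_add, cup_single] at h
      rw [LinearMap.comp_apply, boundary_cons, map_add, hcone, prim_single, cup_single,
        eq_neg_of_add_eq_zero_right h]
      cases l with
      | nil => simp [primList, cupList]
      | cons w l =>
        simp only [primList, cupList, ZModModule.neg_eq_self]
        ring
  exact LinearMap.congr_fun this c

lemma cupList_map_neg {ν : V → V} {S : List (V → ZMod 2)} {q : V → Prop}
    (hS : ∀ s ∈ S, ∀ v, q v → s (ν v) = s v + 1) (l : List V) (hl : ∀ v ∈ l, q v) :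
    cupList S (l.map ν) = cupList S l := by
  induction S generalizing l with
  | nil => match l with
    | [] => rfl
    | [v] => rfl
    | v :: w :: l => rfl
  | cons s S ih => match l with
    | [] => rfl
    | [v] => rfl
    | v :: w :: l =>
      have h := ih (fun t ht => hS t (List.mem_cons_of_mem _ ht)) (w :: l)
        (fun u hu => hl u (List.mem_cons_of_mem _ hu))
      simp only [List.map_cons] at h
      simp only [List.map_cons, cupList, h]
      rw [hS s List.mem_cons_self v (hl v (by simp)), hS s List.mem_cons_self w (hl w (by simp))]
      congr 1
      linear_combination CharTwo.add_self_eq_zero (1 : ZMod 2)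

/-- If `ν` shifts all the `0`-cochains by one, then `prim s S` changes by `cup S` under `ν`. -/
lemma prim_add_vmap {ν : V → V} {s : V → ZMod 2} {S : List (V → ZMod 2)} {q : V → Prop}
    (hS : ∀ t ∈ s :: S, ∀ v, q v → t (ν v) = t v + 1) {c : ListChain V}
    (hc : c ∈ on (fun l => ∀ v ∈ l, q v)) : prim s S (c + vmap ν c) = cup S c := by
  refine eq_of_on (f := prim s S ∘ₗ (LinearMap.id + vmap ν)) (fun l hl => ?_) hc
  simp only [LinearMap.comp_apply, LinearMap.add_apply, LinearMap.id_apply, map_add, vmap_single,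
    prim_single, cup_single]
  cases l with
  | nil => simp [primList]
  | cons v l =>
    have h := cupList_map_neg (fun t ht => hS t (List.mem_cons_of_mem _ ht)) (v :: l) hl
    simp only [List.map_cons] at h
    simp only [List.map_cons, primList, h]
    rw [hS s List.mem_cons_self v (hl v (by simp))]
    linear_combination (s v * cupList S (v :: l)) * CharTwo.add_self_eq_zero (1 : ZMod 2)

lemma exists_ne_of_cupList_ne_zero {S : List (V → ZMod 2)} {l : List V} (h : cupList S l ≠ 0) :
    l ≠ [] ∧ ∀ s ∈ S, ∃ v ∈ l, ∃ w ∈ l, s v ≠ s w := by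
  induction S generalizing l with
  | nil => exact ⟨fun h' => h (by simp [h']), by simp⟩
  | cons s S ih => match l with
    | [] => exact absurd rfl h
    | [v] => exact absurd rfl h
    | v :: w :: l =>
      simp only [cupList] at h
      refine ⟨by simp, fun t ht => ?_⟩
      rcases List.mem_cons.1 ht with rfl | ht
      · refine ⟨v, by simp, w, by simp, fun e => left_ne_zero_of_mul h ?_⟩
        rw [e, CharTwo.add_self_eq_zero]
      · obtain ⟨a, ha, b, hb, hab⟩ := (ih (right_ne_zero_of_mul h)).2 t ht
        exact ⟨a, List.mem_cons_of_mem _ ha, b, List.mem_cons_of_mem _ hb, hab⟩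

end ListChain

/-! ### The subdivided cube and a Borsuk–Ulam theorem -/

namespace ListChain

/-- The vertex `v` with its `j`-th coordinate replaced by `i`. -/
def setCoord (j : ℕ) (i : ℤ) (v : ℕ → ℤ) : ℕ → ℤ := Function.update v j i

/-- The half `{0 ≤ x_j}` of the next cube, subdivided into prisms of height one. -/
def halfCube (N j : ℕ) (T : ListChain (ℕ → ℤ)) : ListChain (ℕ → ℤ) :=
  ∑ i ∈ Finset.range N, prism (setCoord j i) (setCoord j (i + 1)) T

/-- The fundamental chain of the cube `[-N, N]^j`, triangulated with integer vertices. A vertex is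
an element of `ℕ → ℤ` whose coordinates from `j` on vanish. -/
def cube (N : ℕ) : ℕ → ListChain (ℕ → ℤ)
  | 0 => Finsupp.single [0] 1
  | j + 1 => halfCube N j (cube N j) + vmap Neg.neg (halfCube N j (cube N j))

/-- The simplices of `cube N j`: adjacent vertices, in the cube, with coordinates `≥ j` zero. -/
def IsGridSimplex (N j : ℕ) (l : List (ℕ → ℤ)) : Prop :=
  (∀ v ∈ l, ∀ w ∈ l, ∀ i, |v i - w i| ≤ 1) ∧ ∀ v ∈ l, (∀ i, |v i| ≤ N) ∧ ∀ i, j ≤ i → v i = 0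

/-- Simplices in the outer boundary of the cube. -/
def IsOuterSimplex (N j : ℕ) (l : List (ℕ → ℤ)) : Prop :=
  ∀ v ∈ l, (∃ i, |v i| = N) ∧ ∀ i, j ≤ i → v i = 0

lemma vmap_neg_vmap_neg (c : ListChain (ℕ → ℤ)) : vmap Neg.neg (vmap Neg.neg c) = c := by
  have : vmap Neg.neg ∘ₗ vmap Neg.neg = (LinearMap.id : ListChain (ℕ → ℤ) →ₗ[ZMod 2] _) :=
    hom_ext fun l => by simp
  exact LinearMap.congr_fun this c

lemma vmap_neg_cube (N j : ℕ) : vmap Neg.neg (cube N j) = cube N j := by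
  cases j with
  | zero => simp [cube]
  | succ j => rw [cube, map_add, vmap_neg_vmap_neg, add_comm]

lemma isGridSimplex_neg {N j : ℕ} {l : List (ℕ → ℤ)} (h : IsGridSimplex N j l) :
    IsGridSimplex N j (l.map Neg.neg) := by
  refine ⟨fun v hv w hw i => ?_, fun v hv => ?_⟩
  · obtain ⟨v', hv', rfl⟩ := List.mem_map.1 hv
    obtain ⟨w', hw', rfl⟩ := List.mem_map.1 hw
    have := h.1 w' hw' v' hv' i
    simpa [neg_add_eq_sub] using this
  · obtain ⟨v', hv', rfl⟩ := List.mem_map.1 hv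
    exact ⟨fun i => by simpa using (h.2 v' hv').1 i,
      fun i hi => by simpa using (h.2 v' hv').2 i hi⟩

lemma isOuterSimplex_neg {N j : ℕ} {l : List (ℕ → ℤ)} (h : IsOuterSimplex N j l) :
    IsOuterSimplex N j (l.map Neg.neg) := by
  intro v hv
  obtain ⟨v', hv', rfl⟩ := List.mem_map.1 hv
  obtain ⟨⟨i, hi⟩, h2⟩ := h v' hv'
  exact ⟨⟨i, by simpa using hi⟩, fun i hi => by simpa using h2 i hi⟩

lemma halfCube_mem {N j : ℕ} {T : ListChain (ℕ → ℤ)} (hT : T ∈ on (IsGridSimplex N j)) :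
    halfCube N j T ∈ on (IsGridSimplex N (j + 1)) := by
  refine sum_mem fun i hi => map_mem_of_on _ (fun l hl => ?_) hT
  have hiN : i + 1 ≤ N := Finset.mem_range.1 hi
  refine on_mono (fun l' hl' => ⟨fun v hv w hw m => ?_, fun v hv => ⟨fun m => ?_, fun m hm => ?_⟩⟩)
    (prism_single_mem _ _ l)
  · obtain ⟨v', hv', hv⟩ := hl' v hv
    obtain ⟨w', hw', hw⟩ := hl' w hw
    by_cases hm : m = j
    · subst hm
      rcases hv with rfl | rfl <;> rcases hw with rfl | rfl <;> simp [setCoord]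
    · have := hl.1 v' hv' w' hw' m
      rcases hv with rfl | rfl <;> rcases hw with rfl | rfl <;> simpa [setCoord, hm] using this
  · obtain ⟨v', hv', hv⟩ := hl' v hv
    by_cases hm : m = j
    · subst hm
      rcases hv with rfl | rfl <;> simp only [setCoord, Function.update_self] <;>
        rw [abs_of_nonneg (by positivity)] <;> omega
    · have := (hl.2 v' hv').1 m
      rcases hv with rfl | rfl <;> simpa [setCoord, hm] using this
  · obtain ⟨v', hv', hv⟩ := hl' v hv
    have := (hl.2 v' hv').2 m (by omega)
    rcases hv with rfl | rfl <;> simpa [setCoord, show m ≠ j by omega] using this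

lemma cube_mem (N j : ℕ) : cube N j ∈ on (IsGridSimplex N j) := by
  induction j with
  | zero => exact single_mem_on ⟨by simp, by simp⟩
  | succ j ih =>
    exact add_mem (halfCube_mem ih) (map_mem_of_on _
      (fun l hl => by rw [vmap_single]; exact single_mem_on (isGridSimplex_neg hl))
      (halfCube_mem ih))

lemma halfCube_outer_mem {N j : ℕ} (hN : 0 < N) {T : ListChain (ℕ → ℤ)}
    (hT : T ∈ on (IsOuterSimplex N j)) : halfCube N j T ∈ on (IsOuterSimplex N (j + 1)) := by
  refine sum_mem fun i hi => map_mem_of_on _ (fun l hl => ?_) hT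
  refine on_mono (fun l' hl' v hv => ⟨?_, fun m hm => ?_⟩) (prism_single_mem _ _ l)
  · obtain ⟨v', hv', hv⟩ := hl' v hv
    obtain ⟨⟨m, hm⟩, h2⟩ := hl v' hv'
    have hmj : m ≠ j := by
      rintro rfl
      rw [h2 m le_rfl, abs_zero] at hm
      omega
    refine ⟨m, ?_⟩
    rcases hv with rfl | rfl <;> simpa [setCoord, hmj] using hm
  · obtain ⟨v', hv', hv⟩ := hl' v hv
    have := (hl v' hv').2 m (by omega)
    rcases hv with rfl | rfl <;> simpa [setCoord, show m ≠ j by omega] using this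

lemma boundary_halfCube_sum (N j : ℕ) (T : ListChain (ℕ → ℤ)) :
    boundary (halfCube N j T)
      = vmap (setCoord j 0) T + vmap (setCoord j N) T + halfCube N j (boundary T) := by
  simp only [halfCube, map_sum, boundary_prism, Finset.sum_add_distrib]
  congr 1
  induction N with
  | zero => simp [ZModModule.add_self]
  | succ N ih =>
    rw [Finset.sum_range_succ, Finset.sum_range_succ, Nat.cast_succ]
    have h := ZModModule.add_self (vmap (setCoord j N) T)
    linear_combination (norm := module) ih + h

/-- The boundary of the half cube is its bottom together with faces on the outer boundary. -/
lemma boundary_halfCube {N j : ℕ} (hN : 0 < N)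
    (h : boundary (cube N j) ∈ on (IsOuterSimplex N j)) :
    ∃ c ∈ on (IsOuterSimplex N (j + 1)),
      boundary (halfCube N j (cube N j)) = cube N j + c := by
  refine ⟨vmap (setCoord j N) (cube N j) + halfCube N j (boundary (cube N j)),
    add_mem (map_mem_of_on _ (fun l hl => ?_) (cube_mem N j)) (halfCube_outer_mem hN h), ?_⟩
  · rw [vmap_single]
    refine single_mem_on fun v hv => ?_
    obtain ⟨w, hw, rfl⟩ := List.mem_map.1 hv
    refine ⟨⟨j, by simp [setCoord]⟩, fun i hi => ?_⟩
    have := (hl.2 w hw).2 i (by omega)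
    simpa [setCoord, show i ≠ j by omega] using this
  · rw [boundary_halfCube_sum, add_assoc]
    congr 1
    refine eq_of_on (f := vmap (setCoord j 0)) (g := LinearMap.id) (fun l hl => ?_) (cube_mem N j)
    rw [vmap_single, LinearMap.id_apply]
    congr 1
    conv_rhs => rw [← List.map_id l]
    refine List.map_congr_left fun v hv => ?_
    rw [id, setCoord, ← (hl.2 v hv).2 j le_rfl, Function.update_eq_self]

lemma boundary_cube_mem {N : ℕ} (hN : 0 < N) (j : ℕ) :
    boundary (cube N j) ∈ on (IsOuterSimplex N j) := by
  induction j with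
  | zero =>
    simp only [cube, boundary_cons, boundary_nil, map_zero, add_zero]
    exact single_mem_on (by simp [IsOuterSimplex])
  | succ j ih =>
    obtain ⟨c, hc, h⟩ := boundary_halfCube hN ih
    have : boundary (cube N (j + 1)) = c + vmap Neg.neg c := by
      rw [cube, map_add, boundary_vmap, h, map_add, vmap_neg_cube]
      have h := ZModModule.add_self (cube N j)
      linear_combination (norm := module) h
    rw [this]
    exact add_mem hc (map_mem_of_on _
      (fun l hl => by rw [vmap_single]; exact single_mem_on (isOuterSimplex_neg hl)) hc)

/-- The faces of `meeting A (halfCube N j (cube N j))` that have no vertex in `A`: half of the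
discrete boundary of `A` in the coordinate subspace of dimension `j + 1`. -/
def halfFrontier (A : Set (ℕ → ℤ)) (N j : ℕ) : ListChain (ℕ → ℤ) :=
  boundary (meeting A (halfCube N j (cube N j)))
    + meeting A (boundary (meeting A (halfCube N j (cube N j))))

section

variable {A : Set (ℕ → ℤ)} {N : ℕ}

lemma meeting_outer (hA : ∀ v, (∃ i, |v i| = (N : ℤ)) → v ∉ A) {j : ℕ} {c : ListChain (ℕ → ℤ)}
    (hc : c ∈ on (IsOuterSimplex N j)) : meeting A c = 0 :=
  meeting_of_forall (on_mono (fun _ hl v hv => hA v (hl v hv).1) hc)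

lemma meeting_boundary_meeting (c : ListChain (ℕ → ℤ)) :
    meeting A (boundary (meeting A c)) = meeting A (boundary c) := by
  have : meeting A ∘ₗ boundary ∘ₗ meeting A = meeting A ∘ₗ boundary := by
    refine hom_ext fun l => ?_
    simp only [LinearMap.comp_apply]
    by_cases h : ∃ v ∈ l, v ∈ A
    · rw [meeting_single_of_exists h]
    · push Not at h
      rw [meeting_single_of_forall h, map_zero, map_zero]
      exact (meeting_of_forall (on_mono (fun l' hl' v hv => h v (hl' hv))
        (boundary_single_mem l))).symm
  exact LinearMap.congr_fun this c

lemma boundary_meeting_halfCube (hN : 0 < N) (hA : ∀ v, (∃ i, |v i| = (N : ℤ)) → v ∉ A) (j : ℕ) :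
    boundary (meeting A (halfCube N j (cube N j)))
      = halfFrontier A N j + meeting A (cube N j) := by
  obtain ⟨c, hc, h⟩ := boundary_halfCube hN (boundary_cube_mem hN j)
  rw [halfFrontier, meeting_boundary_meeting, h, map_add, meeting_outer hA hc, add_zero, add_assoc,
    ZModModule.add_self, add_zero]

lemma boundary_halfFrontier (hN : 0 < N) (hA : ∀ v, (∃ i, |v i| = (N : ℤ)) → v ∉ A)
    (hneg : ∀ v, -v ∈ A ↔ v ∈ A) (j : ℕ) :
    boundary (halfFrontier A N (j + 1))
      = halfFrontier A N j + vmap Neg.neg (halfFrontier A N j) := by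
  have h1 := congrArg boundary (boundary_meeting_halfCube hN hA (j + 1))
  rw [boundary_boundary, map_add, eq_comm, ← ZModModule.sub_eq_add, sub_eq_zero] at h1
  rw [h1, cube, map_add, map_add, ← vmap_meeting hneg, boundary_vmap,
    boundary_meeting_halfCube hN hA, map_add, vmap_meeting hneg, vmap_neg_cube]
  have h := ZModModule.add_self (meeting A (cube N j))
  linear_combination (norm := module) h

lemma halfFrontier_mem (j : ℕ) : halfFrontier A N j ∈ on (fun l =>
    (∃ l', l ⊆ l' ∧ IsGridSimplex N (j + 1) l' ∧ ∃ v ∈ l', v ∈ A) ∧ ∀ v ∈ l, v ∉ A) :=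
  add_meeting_mem A (map_mem_of_on _
    (fun l hl => on_mono (fun _ hl' => ⟨l, hl', hl.1, hl.2⟩) (boundary_single_mem l))
    (meeting_mem A (halfCube_mem (cube_mem N j))))

/-- The parity computation behind the Borsuk–Ulam theorem: on half of the discrete boundary of a
symmetric neighbourhood of `0`, the cup product of coboundaries of odd `0`-cochains is `1`. -/
lemma cup_halfFrontier (hN : 0 < N) (hA : ∀ v, (∃ i, |v i| = (N : ℤ)) → v ∉ A)
    (hneg : ∀ v, -v ∈ A ↔ v ∈ A) (h0 : (0 : ℕ → ℤ) ∈ A) (S : List ((ℕ → ℤ) → ZMod 2))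
    (hS : ∀ s ∈ S, ∀ v, v ∉ A → s (-v) = s v + 1) : cup S (halfFrontier A N S.length) = 1 := by
  induction S with
  | nil =>
    have h := congrArg (cup []) (boundary_meeting_halfCube hN hA 0)
    rw [cup_boundary, cube, meeting_single_of_exists ⟨0, by simp, h0⟩, map_add, cup_single,
      eq_comm, ← ZModModule.sub_eq_add, sub_eq_zero] at h
    exact h
  | cons s S ih =>
    rw [List.length_cons, ← prim_boundary, boundary_halfFrontier hN hA hneg,
      prim_add_vmap hS (on_mono (fun l hl => hl.2) (halfFrontier_mem _))]
    exact ih fun t ht => hS t (List.mem_cons_of_mem _ ht)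

/-- A symmetric set of grid points containing `0` has a small simplex at its boundary on which all
the given odd `0`-cochains change sign. -/
lemma exists_simplex_sign_change (hN : 0 < N) (hA : ∀ v, (∃ i, |v i| = (N : ℤ)) → v ∉ A)
    (hneg : ∀ v, -v ∈ A ↔ v ∈ A) (h0 : (0 : ℕ → ℤ) ∈ A) (S : List ((ℕ → ℤ) → ZMod 2))
    (hS : ∀ s ∈ S, ∀ v, v ∉ A → s (-v) = s v + 1) :
    ∃ l, IsGridSimplex N (S.length + 1) l ∧ ∃ a ∈ l, a ∈ A ∧ ∃ b ∈ l, b ∉ A ∧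
      ∀ s ∈ S, ∃ v ∈ l, ∃ w ∈ l, v ∉ A ∧ w ∉ A ∧ s v ≠ s w := by
  by_contra hcon
  have h1 := cup_halfFrontier hN hA hneg h0 S hS
  have h2 : cup S (halfFrontier A N S.length) = 0 := by
    refine eq_of_on (f := cup S) (g := 0) (fun l hl => ?_) (halfFrontier_mem S.length)
    rw [cup_single, LinearMap.zero_apply]
    by_contra hne
    obtain ⟨hnil, hch⟩ := exists_ne_of_cupList_ne_zero hne
    obtain ⟨⟨l', hll, hg, a, ha, haA⟩, hlA⟩ := hl
    obtain ⟨b, hb⟩ := List.exists_mem_of_ne_nil l hnil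
    refine hcon ⟨l', hg, a, ha, haA, b, hll hb, hlA b hb, fun s hs => ?_⟩
    obtain ⟨v, hv, w, hw, h⟩ := hch s hs
    exact ⟨v, hll hv, w, hll hw, hlA v hv, hlA w hw, h⟩
  rw [h2] at h1
  exact zero_ne_one h1

end

end ListChain

/-- Some function to `ZMod 2` changes its value under `x ↦ -x` for every `x ≠ 0`. -/
lemma exists_odd_sign (E : Type*) [AddCommGroup E] [IsAddTorsionFree E] :
    ∃ s : E → ZMod 2, ∀ x, x ≠ 0 → s (-x) = s x + 1 := by
  classical
  refine ⟨fun x => if WellOrderingRel x (-x) then 1 else 0, fun x hx => ?_⟩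
  have hne : x ≠ -x := fun h => hx (self_eq_neg.1 h)
  simp only [neg_neg]
  rcases trichotomous_of WellOrderingRel x (-x) with h | h | h
  · have h' : ¬ WellOrderingRel (-x) x := fun h' => asymm_of WellOrderingRel h h'
    simp only [h, h', if_true, if_false]; rfl
  · exact absurd h hne
  · have h' : ¬ WellOrderingRel x (-x) := fun h' => asymm_of WellOrderingRel h h'
    simp [h, h']

/-- A form of the Borsuk–Ulam theorem: `p` odd functions have a common zero on the boundary of a
bounded symmetric neighbourhood of the origin in dimension `p + 1`. -/
theorem exists_common_zero_on_frontier {p : ℕ} {A : Set (Fin (p + 1) → ℝ)} {L : ℝ}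
    (hL : ∀ c ∈ A, ∀ i, |c i| < L) (hneg : ∀ c, -c ∈ A ↔ c ∈ A) (h0 : 0 ∈ A)
    (F : List ((Fin (p + 1) → ℝ) → ℝ)) (hF : F.length = p) (hcont : ∀ f ∈ F, Continuous f)
    (hodd : ∀ f ∈ F, ∀ c, f (-c) = - f c) :
    ∃ z ∈ frontier A, ∀ f ∈ F, f z = 0 := by
  classical
  have hLpos : 0 < L := by simpa using hL 0 h0 0
  obtain ⟨σ, hσ⟩ := exists_odd_sign (ℕ → ℤ)
  obtain ⟨N₀, hN₀⟩ := exists_nat_ge L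
  -- the grid of mesh `1 / (n + 1)`
  let ι : ℕ → (ℕ → ℤ) → (Fin (p + 1) → ℝ) := fun n v i => (v i : ℝ) / (n + 1)
  have hιneg : ∀ n v, ι n (-v) = - ι n v := fun n v => by
    ext i; simp [ι, neg_div]
  let sgn : ℕ → ((Fin (p + 1) → ℝ) → ℝ) → (ℕ → ℤ) → ZMod 2 := fun n f v =>
    if 0 < f (ι n v) then 1 else if f (ι n v) < 0 then 0 else σ v
  have key : ∀ n : ℕ, ∃ l : List (ℕ → ℤ), (∀ v ∈ l, ∀ w ∈ l, dist (ι n v) (ι n w) ≤ 1 / (n + 1)) ∧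
      (∃ a ∈ l, ι n a ∈ A) ∧ (∃ b ∈ l, ι n b ∉ A) ∧
      ∀ f ∈ F, ∃ v ∈ l, ∃ w ∈ l, f (ι n v) ≤ 0 ∧ 0 ≤ f (ι n w) := by
    intro n
    have hn : (0 : ℝ) < n + 1 := by positivity
    -- the vertices outside the coordinate subspace play no role; they are put outside the set
    let A' : Set (ℕ → ℤ) := {v | ι n v ∈ A ∧ ∀ i, p + 1 ≤ i → v i = 0}
    have hN : 0 < (n + 1) * (N₀ + 1) := by positivity
    obtain ⟨l, ⟨hadj, hl⟩, ⟨a, ha, haA, b, hb, hbA, hS⟩⟩ :=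
      ListChain.exists_simplex_sign_change (A := A') hN (fun v ⟨i, hi⟩ hv => by
        by_cases hip : p + 1 ≤ i
        · rw [hv.2 i hip, abs_zero] at hi
          exact hN.ne (by exact_mod_cast hi)
        · have h1 := hL _ hv.1 ⟨i, by omega⟩
          have h2 : |(v i : ℝ)| = (n + 1) * (N₀ + 1) := by exact_mod_cast hi
          simp only [ι, abs_div, h2, abs_of_pos hn] at h1
          rw [mul_div_cancel_left₀ _ hn.ne'] at h1
          linarith)
        (fun v => by simp [A', hιneg, hneg])
        ⟨by convert h0 using 1; ext i; simp [ι], fun i _ => rfl⟩ (F.map (sgn n)) (by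
        intro s hs v hv
        obtain ⟨f, hf, rfl⟩ := List.mem_map.1 hs
        have hv0 : v ≠ 0 := by
          rintro rfl
          exact hv ⟨by convert h0 using 1; ext i; simp [ι], fun i _ => rfl⟩
        simp only [sgn, hιneg, hodd f hf]
        rcases lt_trichotomy (f (ι n v)) 0 with h | h | h
        · simp [h, h.not_gt]
        · simp [h, hσ v hv0]
        · simp only [Left.neg_pos_iff, h.not_gt, if_false, Left.neg_neg_iff, h, if_true]; rfl)
    rw [List.length_map, hF] at hl
    refine ⟨l, fun v hv w hw => ?_, ⟨a, ha, haA.1⟩, ⟨b, hb, fun h => hbA ⟨h, ?_⟩⟩, fun f hf => ?_⟩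
    · refine (dist_pi_le_iff (by positivity)).2 fun i => ?_
      rw [Real.dist_eq]
      simp only [ι]
      rw [← sub_div, abs_div, abs_of_pos hn]
      gcongr
      exact_mod_cast hadj v hv w hw i
    · exact (hl b hb).2
    · obtain ⟨v, hv, w, hw, -, -, hne⟩ := hS _ (List.mem_map_of_mem hf)
      by_contra! hcon
      simp only [sgn] at hne
      by_cases h1 : ∃ u ∈ l, f (ι n u) ≤ 0
      · obtain ⟨u, hu, hfu⟩ := h1
        have h2 : ∀ w ∈ l, f (ι n w) < 0 := fun w hw => hcon u hu w hw hfu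
        simp [h2 v hv, h2 w hw, (h2 v hv).not_gt, (h2 w hw).not_gt] at hne
      · push Not at h1
        simp [h1 v hv, h1 w hw] at hne
  choose l hdist ha hb hch using key
  choose a hal haA using ha
  choose b hbl hbA using hb
  -- the points `ι n (a n)` stay in a compact cube
  have hcpt : IsCompact (Set.Icc (fun _ => -L : Fin (p + 1) → ℝ) (fun _ => L)) := isCompact_Icc
  obtain ⟨z, -, φ, hφ, hz⟩ := hcpt.tendsto_subseq (x := fun n => ι n (a n)) fun n =>
    ⟨fun i => (abs_lt.1 (hL _ (haA n) i)).1.le, fun i => (abs_lt.1 (hL _ (haA n) i)).2.le⟩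
  have hsmall : Tendsto (fun n => 1 / ((φ n : ℝ) + 1)) atTop (𝓝 0) :=
    tendsto_one_div_add_atTop_nhds_zero_nat.comp hφ.tendsto_atTop
  have hall : ∀ v : ℕ → (ℕ → ℤ), (∀ n, v n ∈ l n) →
      Tendsto (fun n => ι (φ n) (v (φ n))) atTop (𝓝 z) := fun v hv => by
    refine (tendsto_iff_of_dist ?_).1 hz
    exact squeeze_zero (fun n => dist_nonneg)
      (fun n => hdist (φ n) _ (hal (φ n)) _ (hv (φ n))) hsmall
  refine ⟨z, ⟨mem_closure_of_tendsto hz (Eventually.of_forall fun n => haA (φ n)), ?_⟩,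
    fun f hf => ?_⟩
  · have : z ∈ closure Aᶜ :=
      mem_closure_of_tendsto (hall b hbl) (Eventually.of_forall fun n => hbA (φ n))
    rwa [closure_compl] at this
  · choose v hv w hw hle hge using fun n => hch n f hf
    have hfz := (hcont f hf).tendsto z
    exact le_antisymm (le_of_tendsto' (hfz.comp (hall v hv)) fun n => hle (φ n))
      (ge_of_tendsto' (hfz.comp (hall w hw)) fun n => hge (φ n))

/-! ### Globally Lipschitz pseudo-gradient fields -/

section Selection

variable {E : Type*} [NormedAddCommGroup E]

/-- The `n`-th layer of a `σ`-disjoint refinement of the cover by the balls `ball x (ρ x)`: for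
fixed `n` and varying `x` these open sets are pairwise disjoint. -/
def layer (ρ : E → ℝ) (n : ℕ) (x : E) : Set E :=
  interior {y | (1 / 2 : ℝ) ^ n < ρ x - dist y x ∧
    ∀ x', WellOrderingRel x' x → ρ x' - dist y x' ≤ (1 / 2 : ℝ) ^ n}

lemma layer_subset_ball (ρ : E → ℝ) (n : ℕ) (x : E) : layer ρ n x ⊆ Metric.ball x (ρ x) := by
  intro y hy
  have h := (interior_subset hy).1
  have : (0 : ℝ) < (1 / 2) ^ n := by positivity
  rw [Metric.mem_ball]
  linarith

lemma layer_disjoint {ρ : E → ℝ} {n : ℕ} {x x' y : E} (h : y ∈ layer ρ n x)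
    (h' : y ∈ layer ρ n x') : x = x' := by
  have h1 := interior_subset h
  have h2 := interior_subset h'
  rcases trichotomous_of WellOrderingRel x x' with hr | hr | hr
  · exact absurd h1.1 (not_lt.2 (h2.2 x hr))
  · exact hr
  · exact absurd h2.1 (not_lt.2 (h1.2 x' hr))

lemma exists_mem_layer {ρ : E → ℝ} (hρ : ∀ x, 0 < ρ x) (y : E) : ∃ n x, y ∈ layer ρ n x := by
  -- the least index among the balls containing `y`
  obtain ⟨x, hx, hmin⟩ := (inferInstance : IsWellFounded E WellOrderingRel).wf.has_min
    {x | 0 < ρ x - dist y x} ⟨y, by simpa using hρ y⟩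
  obtain ⟨n, hn⟩ := exists_pow_lt_of_lt_one (show 0 < ρ x - dist y x from hx)
    (by norm_num : (1 / 2 : ℝ) < 1)
  refine ⟨n, x, mem_interior_iff_mem_nhds.2 ?_⟩
  have hpos : (0 : ℝ) < (1 / 2) ^ n := by positivity
  filter_upwards [Metric.ball_mem_nhds y (lt_min hpos (sub_pos.2 hn))] with z hz
  rw [Metric.mem_ball, lt_min_iff] at hz
  refine ⟨?_, fun x' hx' => ?_⟩
  · linarith [dist_triangle z y x, hz.2]
  · have h1 : ρ x' - dist y x' ≤ 0 := not_lt.1 fun h => hmin x' h hx'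
    linarith [dist_triangle y z x', dist_comm y z, hz.1]

lemma min_infDist_nonneg (y : E) (s : Set E) : 0 ≤ min 1 (Metric.infDist y s) :=
  le_min zero_le_one Metric.infDist_nonneg

variable [NormedSpace ℝ E]

open Classical in
/-- The field that equals `v x` times the (truncated) distance to the complement on each
`layer ρ n x`, and vanishes outside these sets. -/
def layerField (ρ : E → ℝ) (v : E → E) (n : ℕ) (y : E) : E :=
  if h : ∃ x, y ∈ layer ρ n x then
    min 1 (Metric.infDist y (layer ρ n h.choose)ᶜ) • v h.choose else 0

lemma layerField_of_mem {ρ : E → ℝ} (v : E → E) {n : ℕ} {x y : E} (h : y ∈ layer ρ n x) :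
    layerField ρ v n y = min 1 (Metric.infDist y (layer ρ n x)ᶜ) • v x := by
  have h' : ∃ x, y ∈ layer ρ n x := ⟨x, h⟩
  rw [layerField, dif_pos h', layer_disjoint h'.choose_spec h]

lemma layerField_of_forall_notMem {ρ : E → ℝ} (v : E → E) {n : ℕ} {y : E}
    (h : ∀ x, y ∉ layer ρ n x) : layerField ρ v n y = 0 := by
  rw [layerField, dif_neg (by simpa using h)]

lemma norm_layerField_le_one {ρ : E → ℝ} {v : E → E} (hv : ∀ x, ‖v x‖ ≤ 1) (n : ℕ) (y : E) :
    ‖layerField ρ v n y‖ ≤ 1 := by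
  by_cases h : ∃ x, y ∈ layer ρ n x
  · obtain ⟨x, hx⟩ := h
    rw [layerField_of_mem v hx, norm_smul, Real.norm_of_nonneg (min_infDist_nonneg _ _)]
    exact mul_le_one₀ (min_le_left _ _) (norm_nonneg _) (hv x)
  · push Not at h
    simp [layerField_of_forall_notMem v h]

lemma norm_layerField_le_dist {ρ : E → ℝ} {v : E → E} (hv : ∀ x, ‖v x‖ ≤ 1) {n : ℕ} {x y z : E}
    (hy : y ∈ layer ρ n x) (hz : z ∉ layer ρ n x) : ‖layerField ρ v n y‖ ≤ dist y z := by
  rw [layerField_of_mem v hy, norm_smul, Real.norm_of_nonneg (min_infDist_nonneg _ _)]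
  calc _ ≤ Metric.infDist y (layer ρ n x)ᶜ * 1 := by
        gcongr
        · exact Metric.infDist_nonneg
        · exact min_le_right _ _
        · exact hv x
    _ ≤ dist y z := by
        rw [mul_one]; exact Metric.infDist_le_dist_of_mem hz

lemma norm_layerField_sub_le {ρ : E → ℝ} {v : E → E} (hv : ∀ x, ‖v x‖ ≤ 1) (n : ℕ) (y z : E) :
    ‖layerField ρ v n y - layerField ρ v n z‖ ≤ 2 * dist y z := by
  have aux : ∀ y z x, y ∈ layer ρ n x → z ∉ layer ρ n x →
      ‖layerField ρ v n y - layerField ρ v n z‖ ≤ 2 * dist y z := by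
    intro y z x hy hz
    have h1 := norm_layerField_le_dist hv hy hz
    have h2 : ‖layerField ρ v n z‖ ≤ dist y z := by
      by_cases h : ∃ x', z ∈ layer ρ n x'
      · obtain ⟨x', hx'⟩ := h
        rw [dist_comm]
        refine norm_layerField_le_dist hv hx' fun hy' => hz ?_
        rwa [layer_disjoint hy hy']
      · push Not at h
        simp [layerField_of_forall_notMem v h]
    linarith [norm_sub_le (layerField ρ v n y) (layerField ρ v n z)]
  by_cases h : ∃ x, y ∈ layer ρ n x
  · obtain ⟨x, hx⟩ := h
    by_cases hz : z ∈ layer ρ n x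
    · rw [layerField_of_mem v hx, layerField_of_mem v hz, ← sub_smul, norm_smul, Real.norm_eq_abs]
      have h1 : |min 1 (Metric.infDist y (layer ρ n x)ᶜ) - min 1 (Metric.infDist z (layer ρ n x)ᶜ)|
          ≤ dist y z := by
        have := ((Metric.lipschitz_infDist_pt ((layer ρ n x)ᶜ)).const_min 1).dist_le_mul y z
        simpa [Real.dist_eq] using this
      calc _ ≤ dist y z * 1 := by gcongr; exact hv x
        _ ≤ _ := by linarith [dist_nonneg (x := y) (y := z)]
    · exact aux y z x hx hz
  · push Not at h
    by_cases h' : ∃ x, z ∈ layer ρ n x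
    · obtain ⟨x, hx⟩ := h'
      rw [norm_sub_rev, dist_comm]
      exact aux z y x hx (h x)
    · push Not at h'
      simp [layerField_of_forall_notMem v h, layerField_of_forall_notMem v h']

/-- Gluing of locally chosen directions into one globally Lipschitz field: if near every point some
vector `v` of norm at most one satisfies `c ‖g y‖ ‖v‖ ≤ g y v`, then so does a globally
Lipschitz field, and strict positivity of `g y v` on a set is inherited. The weights `2⁻ⁿ` along a
`σ`-disjoint refinement make the global Lipschitz constant finite. -/
lemma exists_lipschitz_selection [CompleteSpace E] [Nontrivial E] (g : E → StrongDual ℝ E) {c : ℝ}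
    (hc : 0 ≤ c) (s : Set E)
    (hloc : ∀ x, ∃ ρ > 0, ∃ v : E, ‖v‖ ≤ 1 ∧ ∀ y ∈ Metric.ball x ρ,
      c * ‖g y‖ * ‖v‖ ≤ g y v ∧ (y ∈ s → 0 < g y v)) :
    ∃ V : E → E, (∀ y z, ‖V y - V z‖ ≤ 2 * dist y z) ∧ (∀ y, ‖V y‖ ≤ 1) ∧
      (∀ y, c * ‖g y‖ * ‖V y‖ ≤ g y (V y)) ∧ ∀ y ∈ s, 0 < g y (V y) := by
  choose ρ hρ v hv hgv using hloc
  have hgeo : HasSum (fun n : ℕ => (1 / 2 : ℝ) ^ (n + 1)) 1 := by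
    have h := hasSum_geometric_two.mul_right (1 / 2 : ℝ)
    rw [mul_one_div_cancel two_ne_zero] at h
    simpa only [pow_succ] using h
  let W : ℕ → E → E := fun n y => (1 / 2 : ℝ) ^ (n + 1) • layerField ρ v n y
  have hWn : ∀ n y, ‖W n y‖ = (1 / 2 : ℝ) ^ (n + 1) * ‖layerField ρ v n y‖ := fun n y => by
    rw [norm_smul, Real.norm_of_nonneg (by positivity)]
  have hWle : ∀ n y, ‖W n y‖ ≤ (1 / 2 : ℝ) ^ (n + 1) := fun n y => by
    rw [hWn]
    exact mul_le_of_le_one_right (by positivity) (norm_layerField_le_one hv n y)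
  have hWs : ∀ y, Summable fun n => ‖W n y‖ := fun y =>
    hgeo.summable.of_nonneg_of_le (fun n => norm_nonneg _) (fun n => hWle n y)
  have hW : ∀ y, Summable fun n => W n y := fun y => (hWs y).of_norm
  have hg : ∀ n y, c * ‖g y‖ * ‖W n y‖ ≤ g y (W n y) := fun n y => by
    rw [hWn, map_smul, smul_eq_mul]
    have : c * ‖g y‖ * ‖layerField ρ v n y‖ ≤ g y (layerField ρ v n y) := by
      by_cases h : ∃ x, y ∈ layer ρ n x
      · obtain ⟨x, hx⟩ := h
        have h1 := (hgv x y (layer_subset_ball ρ n x hx)).1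
        rw [layerField_of_mem v hx, norm_smul, Real.norm_of_nonneg (min_infDist_nonneg _ _),
          map_smul, smul_eq_mul]
        nlinarith [min_infDist_nonneg y (layer ρ n x)ᶜ]
      · push Not at h
        simp [layerField_of_forall_notMem v h]
    have h2 : (0 : ℝ) ≤ (1 / 2) ^ (n + 1) := by positivity
    nlinarith
  have hg0 : ∀ n y, 0 ≤ g y (W n y) := fun n y => le_trans (by positivity) (hg n y)
  refine ⟨fun y => ∑' n, W n y, fun y z => ?_, fun y => ?_, fun y => ?_, fun y hy => ?_⟩
  · rw [← (hW y).tsum_sub (hW z)]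
    refine tsum_of_norm_bounded (g := fun n => (1 / 2 : ℝ) ^ (n + 1) * (2 * dist y z)) ?_
      fun n => ?_
    · simpa using hgeo.mul_right (2 * dist y z)
    · simp only [W]
      rw [← smul_sub, norm_smul, Real.norm_of_nonneg (by positivity)]
      gcongr
      exact norm_layerField_sub_le hv n y z
  · exact tsum_of_norm_bounded hgeo fun n => hWle n y
  · rw [(g y).map_tsum (hW y)]
    calc _ ≤ c * ‖g y‖ * ∑' n, ‖W n y‖ := by
          gcongr
          exact norm_tsum_le_tsum_norm (hWs y)
      _ = ∑' n, c * ‖g y‖ * ‖W n y‖ := by rw [tsum_mul_left]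
      _ ≤ _ := ((hWs y).mul_left _).tsum_le_tsum (fun n => hg n y) ((g y).summable (hW y))
  · rw [(g y).map_tsum (hW y)]
    obtain ⟨n, x, hx⟩ := exists_mem_layer hρ y
    refine ((g y).summable (hW y)).tsum_pos (fun n => hg0 n y) n ?_
    have hne : ((layer ρ n x)ᶜ).Nonempty := by
      obtain ⟨z, hz⟩ := NormedSpace.exists_lt_norm ℝ E (ρ x)
      refine ⟨x + z, fun h => ?_⟩
      have := layer_subset_ball ρ n x h
      rw [Metric.mem_ball, dist_self_add_left] at this
      linarith
    have hpos : 0 < min 1 (Metric.infDist y (layer ρ n x)ᶜ) :=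
      lt_min one_pos (((isOpen_interior.isClosed_compl).notMem_iff_infDist_pos hne).1
        (Set.notMem_compl_iff.2 hx))
    simp only [W]
    rw [layerField_of_mem v hx, map_smul, map_smul, smul_eq_mul, smul_eq_mul]
    have := (hgv x y (layer_subset_ball ρ n x hx)).2 hy
    positivity

/-- A continuous odd covector field `g` without zeros outside an open set `O` has a
globally Lipschitz, bounded, odd pseudo-gradient field. -/
lemma exists_lipschitz_pseudogradient [CompleteSpace E] [Nontrivial E] {g : E → StrongDual ℝ E}
    (hg : Continuous g) (hodd : ∀ x, g (-x) = - g x) {O : Set E} (hO : IsOpen O)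
    (hzero : ∀ x, g x = 0 → x ∈ O) :
    ∃ V : E → E, LipschitzWith 2 V ∧ (∀ x, ‖V x‖ ≤ 1) ∧ (∀ x, V (-x) = - V x) ∧
      (∀ x, 1 / 2 * ‖g x‖ * ‖V x‖ ≤ g x (V x)) ∧ ∀ x, x ∉ O → 0 < g x (V x) := by
  obtain ⟨V, h1, h2, h3, h4⟩ := exists_lipschitz_selection g (c := 1 / 2) (by norm_num) Oᶜ (by
    intro x
    by_cases hx : x ∈ O
    · obtain ⟨ρ, hρ, hb⟩ := Metric.isOpen_iff.1 hO x hx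
      exact ⟨ρ, hρ, 0, by simp, fun y hy => ⟨by simp, fun h => absurd (hb hy) h⟩⟩
    · have hgx : 0 < ‖g x‖ := norm_pos_iff.2 fun h => hx (hzero x h)
      obtain ⟨v, hv1, hv⟩ : ∃ v : E, ‖v‖ ≤ 1 ∧ 1 / 2 * ‖g x‖ < g x v := by
        obtain ⟨v, hv1, hv⟩ := (g x).exists_lt_apply_of_lt_opNorm
          (show 1 / 2 * ‖g x‖ < ‖g x‖ by linarith)
        rw [Real.norm_eq_abs] at hv
        rcases le_total 0 (g x v) with h | h
        · exact ⟨v, hv1.le, by rwa [abs_of_nonneg h] at hv⟩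
        · exact ⟨-v, by simpa using hv1.le, by rwa [abs_of_nonpos h, ← map_neg] at hv⟩
      have hev : ∀ᶠ y in 𝓝 x, 1 / 2 * ‖g y‖ < g y v :=
        (continuous_const.mul hg.norm).continuousAt.eventually_lt
          (hg.clm_apply continuous_const).continuousAt hv
      obtain ⟨ρ, hρ, hb⟩ := Metric.eventually_nhds_iff_ball.1 hev
      refine ⟨ρ, hρ, v, hv1, fun y hy => ?_⟩
      have h := hb y hy
      have h' : 0 ≤ 1 / 2 * ‖g y‖ := by positivity
      exact ⟨(mul_le_of_le_one_right h' hv1).trans h.le, fun _ => h'.trans_lt h⟩)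
  -- antisymmetrization keeps the inequalities, because `g` is odd
  have key : ∀ x, g x ((1 / 2 : ℝ) • (V x - V (-x))) = 1 / 2 * (g x (V x) + g (-x) (V (-x))) := by
    intro x
    rw [map_smul, map_sub, hodd, smul_eq_mul]
    simp [sub_eq_add_neg]
  have hnorm : ∀ x, ‖(1 / 2 : ℝ) • (V x - V (-x))‖ ≤ 1 / 2 * (‖V x‖ + ‖V (-x)‖) := fun x => by
    rw [norm_smul, Real.norm_of_nonneg (by norm_num)]
    gcongr
    exact norm_sub_le _ _
  have hgn : ∀ x, ‖g (-x)‖ = ‖g x‖ := fun x => by rw [hodd, norm_neg]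
  refine ⟨fun x => (1 / 2 : ℝ) • (V x - V (-x)), LipschitzWith.of_dist_le_mul fun x y => ?_,
    fun x => ?_, fun x => ?_, fun x => ?_, fun x hx => ?_⟩
  · have e : (1 / 2 : ℝ) • (V x - V (-x)) - (1 / 2 : ℝ) • (V y - V (-y))
        = (1 / 2 : ℝ) • ((V x - V y) - (V (-x) - V (-y))) := by module
    rw [dist_eq_norm, e, norm_smul, Real.norm_of_nonneg (by norm_num)]
    have h5 := h1 x y
    have h6 := h1 (-x) (-y)
    rw [dist_neg_neg] at h6
    have := norm_sub_le (V x - V y) (V (-x) - V (-y))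
    simp only [NNReal.coe_ofNat]
    linarith
  · linarith [hnorm x, h2 x, h2 (-x)]
  · simp only [neg_neg]
    module
  · rw [key]
    have h5 := h3 x
    have h6 := h3 (-x)
    rw [hgn] at h6
    have h7 : 1 / 2 * ‖g x‖ * ‖(1 / 2 : ℝ) • (V x - V (-x))‖
        ≤ 1 / 2 * ‖g x‖ * (1 / 2 * (‖V x‖ + ‖V (-x)‖)) := by
      gcongr
      exact hnorm x
    linarith
  · rw [key]
    have h5 := h4 x hx
    have h6 : 0 ≤ g (-x) (V (-x)) := le_trans (by positivity) (h3 (-x))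
    linarith

end Selection

/-! ### The flow of a bounded Lipschitz field -/

section Flow

variable {E : Type*} [NormedAddCommGroup E] [NormedSpace ℝ E]

/-- `η` is a solution of `η' = W(η)` on `[0, ∞)`. -/
def IsForwardSolution (W : E → E) (η : ℝ → E) : Prop :=
  ContinuousOn η (Set.Ici 0) ∧ ∀ t, 0 ≤ t → HasDerivWithinAt η (W (η t)) (Set.Ici t) t

lemma IsForwardSolution.dist_le {W : E → E} {C : NNReal} (hW : LipschitzWith C W) {η ζ : ℝ → E}
    (hη : IsForwardSolution W η) (hζ : IsForwardSolution W ζ) {t : ℝ} (ht : 0 ≤ t) :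
    dist (η t) (ζ t) ≤ dist (η 0) (ζ 0) * Real.exp (C * t) := by
  have := dist_le_of_trajectories_ODE (v := fun _ => W) (fun _ => hW)
    (hη.1.mono (Set.Icc_subset_Ici_self : Set.Icc 0 t ⊆ _)) (fun s hs => hη.2 s hs.1)
    (hζ.1.mono (Set.Icc_subset_Ici_self : Set.Icc 0 t ⊆ _)) (fun s hs => hζ.2 s hs.1) le_rfl
    t ⟨ht, le_rfl⟩
  simpa using this

lemma IsForwardSolution.eq {W : E → E} {C : NNReal} (hW : LipschitzWith C W) {η ζ : ℝ → E}
    (hη : IsForwardSolution W η) (hζ : IsForwardSolution W ζ) (h0 : η 0 = ζ 0) {t : ℝ}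
    (ht : 0 ≤ t) : η t = ζ t := by
  have := hη.dist_le hW hζ ht
  rw [h0, dist_self, zero_mul] at this
  exact dist_le_zero.1 this

lemma exists_forwardSolution [CompleteSpace E] {W : E → E} {C : NNReal} (hW : LipschitzWith C W)
    (hb : ∀ x, ‖W x‖ ≤ 1) (x : E) : ∃ η, η 0 = x ∧ IsForwardSolution W η := by
  have key : ∀ n : ℕ, ∃ α : ℝ → E, α 0 = x ∧
      ∀ t ∈ Set.Icc (0 : ℝ) n, HasDerivWithinAt α (W (α t)) (Set.Icc 0 (n : ℝ)) t := by
    intro n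
    have hn : (0 : ℝ) ≤ n := Nat.cast_nonneg n
    have hPL : IsPicardLindelof (fun _ => W) (tmin := 0) (tmax := n)
        ⟨0, ⟨le_rfl, hn⟩⟩ x n 0 1 C :=
      { lipschitzOnWith := fun _ _ => hW.lipschitzOnWith
        continuousOn := fun _ _ => continuousOn_const
        norm_le := fun _ _ y _ => by simpa using hb y
        mul_max_le := by simp }
    exact hPL.exists_eq_forall_mem_Icc_hasDerivWithinAt₀
  choose α h0 hα using key
  have hcont : ∀ n, ContinuousOn (α n) (Set.Icc 0 (n : ℝ)) := fun n t ht =>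
    (hα n t ht).continuousWithinAt
  have hright : ∀ n : ℕ, ∀ t ∈ Set.Ico (0 : ℝ) n,
      HasDerivWithinAt (α n) (W (α n t)) (Set.Ici t) t := fun n t ht =>
    (hα n t ⟨ht.1, ht.2.le⟩).mono_of_mem_nhdsWithin
      (mem_of_superset (Icc_mem_nhdsGE ht.2) (Set.Icc_subset_Icc_left ht.1))
  -- solutions on different intervals agree
  have hagree : ∀ m n : ℕ, m ≤ n → ∀ t ∈ Set.Icc (0 : ℝ) m, α m t = α n t := by
    intro m n hmn t ht
    have hmn' : (m : ℝ) ≤ n := by exact_mod_cast hmn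
    have := dist_le_of_trajectories_ODE (v := fun _ => W) (fun _ => hW) (hcont m)
      (fun s hs => hright m s hs) ((hcont n).mono (Set.Icc_subset_Icc_right hmn'))
      (fun s hs => hright n s ⟨hs.1, hs.2.trans_le hmn'⟩) le_rfl t ht
    rw [h0, h0, dist_self, zero_mul] at this
    exact dist_le_zero.1 this
  let η : ℝ → E := fun t => α (⌈t⌉₊ + 1) t
  have hη : ∀ (n : ℕ) (t : ℝ), t ∈ Set.Icc (0 : ℝ) n → η t = α n t := by
    intro n t ht
    have h1 : t ≤ (⌈t⌉₊ + 1 : ℕ) := by push_cast; linarith [Nat.le_ceil t]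
    rcases le_total (⌈t⌉₊ + 1) n with h | h
    · exact hagree _ _ h t ⟨ht.1, h1⟩
    · exact (hagree _ _ h t ht).symm
  have hev : ∀ t, 0 ≤ t → ∃ n : ℕ, t ∈ Set.Ico (0 : ℝ) n ∧ η =ᶠ[𝓝[Set.Ici 0] t] α n := by
    intro t ht
    obtain ⟨n, hn⟩ := exists_nat_gt t
    refine ⟨n, ⟨ht, hn⟩, ?_⟩
    filter_upwards [self_mem_nhdsWithin, mem_nhdsWithin_of_mem_nhds (Iio_mem_nhds hn)] with s hs hs'
    exact hη n s ⟨hs, (show s < n from hs').le⟩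
  refine ⟨η, ?_, fun t ht => ?_, fun t ht => ?_⟩
  · rw [hη 0 0 (by simp), h0]
  · obtain ⟨n, hn, he⟩ := hev t ht
    refine ContinuousWithinAt.congr_of_eventuallyEq ?_ he (hη n t ⟨hn.1, hn.2.le⟩)
    refine (hcont n t ⟨hn.1, hn.2.le⟩).mono_of_mem_nhdsWithin ?_
    filter_upwards [self_mem_nhdsWithin, mem_nhdsWithin_of_mem_nhds (Iio_mem_nhds hn.2)]
      with s hs hs'
    exact ⟨hs, (show s < n from hs').le⟩
  · obtain ⟨n, hn, he⟩ := hev t ht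
    rw [hη n t ⟨hn.1, hn.2.le⟩]
    exact (hright n t hn).congr_of_eventuallyEq
      (he.filter_mono (nhdsWithin_mono t (Set.Ici_subset_Ici.2 ht))) (hη n t ⟨hn.1, hn.2.le⟩)

end Flow

/-! ### Descent curves of a functional without compactness -/

/-- A curve on which displacements cost a definite drop of `Φ ≥ 0` converges. -/
lemma exists_tendsto_of_drop {E : Type*} [NormedAddCommGroup E] [CompleteSpace E] {Φ : E → ℝ}
    {η : ℝ → E} {δ : ℝ} (hδ : 0 < δ) (hnn : ∀ t, 0 ≤ t → 0 ≤ Φ (η t))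
    (hU : ∀ ε, 0 < ε → ε < δ → ∃ μ > 0, ∀ s t, 0 ≤ s → s ≤ t → ε ≤ ‖η t - η s‖ →
      μ ≤ Φ (η s) - Φ (η t)) : ∃ ℓ, Tendsto η atTop (𝓝 ℓ) := by
  refine cauchySeq_tendsto_of_complete (Metric.cauchySeq_iff'.2 fun ε hε => ?_)
  obtain ⟨μ, hμ, h⟩ := hU (min (ε / 2) (δ / 2)) (lt_min (by linarith) (by linarith))
    ((min_le_right _ _).trans_lt (by linarith))
  let S : Set ℝ := (fun t => Φ (η t)) '' Set.Ici 0
  have hS : BddBelow S := ⟨0, by rintro _ ⟨t, ht, rfl⟩; exact hnn t ht⟩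
  obtain ⟨_, ⟨T, hT, rfl⟩, hlt⟩ := exists_lt_of_csInf_lt
    (⟨_, 0, Set.self_mem_Ici, rfl⟩ : S.Nonempty) (show sInf S < sInf S + μ by linarith)
  refine ⟨T, fun t ht => ?_⟩
  rw [dist_eq_norm]
  by_contra! hge
  have h1 := h T t hT ht ((min_le_left _ _).trans (by linarith))
  have h2 : sInf S ≤ Φ (η t) := csInf_le hS ⟨t, le_trans hT ht, rfl⟩
  linarith

section Descent

variable {E : Type*} [NormedAddCommGroup E] [NormedSpace ℝ E]

/-- A curve on `[0, ∞)` along which `Φ` decreases at least at half of the largest rate possible for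
its speed. -/
def IsDescentCurve (Φ : E → ℝ) (η : ℝ → E) : Prop :=
  ContinuousOn η (Set.Ici 0) ∧ ∃ η' : ℝ → E, ∀ t, 0 ≤ t →
    HasDerivWithinAt η (η' t) (Set.Ici t) t ∧
      1 / 2 * ‖fderiv ℝ Φ (η t)‖ * ‖η' t‖ ≤ - fderiv ℝ Φ (η t) (η' t)

/-- Sequences of points with `0 ≤ Φ ≤ β` that satisfy Cerami's condition. -/
def IsCeramiIn (Φ : E → ℝ) (β : ℝ) (u : ℕ → E) : Prop :=
  (∀ n, 0 ≤ Φ (u n) ∧ Φ (u n) ≤ β) ∧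
    Tendsto (fun n => (1 + ‖u n‖) * ‖fderiv ℝ Φ (u n)‖) atTop (𝓝 0)

variable {Φ : E → ℝ} {η : ℝ → E}

lemma hasDerivWithinAt_comp_right (hΦ : Differentiable ℝ Φ) {v : E} {t : ℝ}
    (h : HasDerivWithinAt η v (Set.Ici t) t) :
    HasDerivWithinAt (fun s => Φ (η s)) (fderiv ℝ Φ (η t) v) (Set.Ici t) t :=
  (hΦ (η t)).hasFDerivAt.comp_hasDerivWithinAt t h

lemma IsDescentCurve.le (hΦ : Differentiable ℝ Φ) (hη : IsDescentCurve Φ η) {s t : ℝ} (hs : 0 ≤ s)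
    (hst : s ≤ t) : Φ (η t) ≤ Φ (η s) := by
  obtain ⟨hc, η', h⟩ := hη
  refine image_le_of_deriv_right_le_deriv_boundary (f := fun x => Φ (η x)) (a := s) (b := t)
    (hΦ.continuous.comp_continuousOn (hc.mono fun x hx => hs.trans hx.1))
    (fun x hx => hasDerivWithinAt_comp_right hΦ (h x (hs.trans hx.1)).1) le_rfl
    (B := fun _ => Φ (η s)) (B' := fun _ => 0) continuousOn_const
    (fun x _ => hasDerivWithinAt_const _ _ _) (fun x hx => ?_) ⟨hst, le_rfl⟩
  have h1 := (h x (hs.trans hx.1)).2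
  have h2 : 0 ≤ 1 / 2 * ‖fderiv ℝ Φ (η x)‖ * ‖η' x‖ := by positivity
  linarith

/-- A descent curve that moves by more than `ρ` while `Φ` drops by less than `c ρ / 2` passes,
within distance `ρ` of its starting point, a point where the derivative is at most `c`. -/
lemma IsDescentCurve.exists_small_fderiv (hΦ : Differentiable ℝ Φ) (hη : IsDescentCurve Φ η)
    {s t ρ c : ℝ} (hs : 0 ≤ s) (hst : s ≤ t) (hc : 0 < c) (hmove : ρ < ‖η t - η s‖)
    (hdrop : Φ (η s) - Φ (η t) < c * ρ / 2) :
    ∃ x ∈ Set.Icc s t, ‖η x - η s‖ ≤ ρ ∧ ‖fderiv ℝ Φ (η x)‖ ≤ c := by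
  by_contra! hcon
  have hmono := fun {x y : ℝ} (hx : 0 ≤ x) (hxy : x ≤ y) => hη.le hΦ hx hxy
  obtain ⟨hcont, η', h⟩ := hη
  -- a small positive slope makes the comparison strict
  obtain ⟨κ, hκ, hκt⟩ : ∃ κ > 0, 2 / c * (Φ (η s) - Φ (η t)) + κ * (t - s) ≤ ρ := by
    have hpos : 0 < ρ - 2 / c * (Φ (η s) - Φ (η t)) := by
      have : 2 / c * (Φ (η s) - Φ (η t)) < 2 / c * (c * ρ / 2) := by gcongr
      have e : 2 / c * (c * ρ / 2) = ρ := by field_simp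
      linarith
    refine ⟨(ρ - 2 / c * (Φ (η s) - Φ (η t))) / (t - s + 1), by
      have : 0 < t - s + 1 := by linarith
      positivity, ?_⟩
    have h1 : 0 < t - s + 1 := by linarith
    have h2 : (ρ - 2 / c * (Φ (η s) - Φ (η t))) / (t - s + 1) * (t - s)
        ≤ ρ - 2 / c * (Φ (η s) - Φ (η t)) := by
      rw [div_mul_eq_mul_div, div_le_iff₀ h1]
      nlinarith
    linarith
  have hBle : ∀ x ∈ Set.Icc s t, 2 / c * (Φ (η s) - Φ (η x)) + κ * (x - s) ≤ ρ := fun x hx => by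
    have h1 : 2 / c * (Φ (η s) - Φ (η x)) ≤ 2 / c * (Φ (η s) - Φ (η t)) := by
      gcongr
      exact hmono (hs.trans hx.1) hx.2
    have h2 : κ * (x - s) ≤ κ * (t - s) := by gcongr; exact hx.2
    linarith
  have hsub : Set.Icc s t ⊆ Set.Ici 0 := fun x hx => hs.trans hx.1
  have key := image_norm_le_of_norm_deriv_right_lt_deriv_boundary' (f := fun x => η x - η s)
    (f' := η') (a := s) (b := t) ((hcont.mono hsub).sub continuousOn_const)
    (fun x hx => (h x (hs.trans hx.1)).1.sub_const _)
    (B := fun x => 2 / c * (Φ (η s) - Φ (η x)) + κ * (x - s))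
    (B' := fun x => 2 / c * (- fderiv ℝ Φ (η x) (η' x)) + κ * 1) (by simp)
    ((continuousOn_const.mul (continuousOn_const.sub
      (hΦ.continuous.comp_continuousOn (hcont.mono hsub)))).add (by fun_prop))
    (fun x hx => (((hasDerivWithinAt_comp_right hΦ (h x (hs.trans hx.1)).1).const_sub _).const_mul
      _).add (((hasDerivWithinAt_id x _).sub_const s).const_mul κ)) (fun x hx heq => by
      have hg := hcon x ⟨hx.1, hx.2.le⟩ (heq.le.trans (hBle x ⟨hx.1, hx.2.le⟩))
      have hd := (h x (hs.trans hx.1)).2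
      have h1 : 1 / 2 * c * ‖η' x‖ ≤ 1 / 2 * ‖fderiv ℝ Φ (η x)‖ * ‖η' x‖ := by gcongr
      have h2 : 2 / c * (1 / 2 * c * ‖η' x‖) ≤ 2 / c * (- fderiv ℝ Φ (η x) (η' x)) := by
        gcongr
        exact h1.trans hd
      have e : 2 / c * (1 / 2 * c * ‖η' x‖) = ‖η' x‖ := by field_simp
      linarith) ⟨hst, le_rfl⟩
  exact absurd (key.trans (hBle t ⟨hst, le_rfl⟩)) (not_le.2 hmove)

/-- A descent curve stays bounded, with a bound depending only on the listed constants, if the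
weighted derivative is bounded below far from the origin. -/
lemma IsDescentCurve.norm_le (hΦ : Differentiable ℝ Φ) (hη : IsDescentCurve Φ η) {R τ β : ℝ}
    (hτ : 0 < τ) (h0 : ‖η 0‖ ≤ R) (hβ : ∀ t, 0 ≤ t → Φ (η 0) - Φ (η t) ≤ β)
    (hfar : ∀ t, 0 ≤ t → R ≤ ‖η t‖ → τ ≤ (1 + ‖η t‖) * ‖fderiv ℝ Φ (η t)‖) {t : ℝ} (ht : 0 ≤ t) :
    ‖η t‖ ≤ (1 + R) * Real.exp (2 / τ * (β + 1)) := by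
  have hmono := fun {x y : ℝ} (hx : 0 ≤ x) (hxy : x ≤ y) => hη.le hΦ hx hxy
  obtain ⟨hcont, η', h⟩ := hη
  have hR : 0 ≤ R := (norm_nonneg _).trans h0
  -- a small positive slope makes the comparison strict
  obtain ⟨κ, hκ, hκt⟩ : ∃ κ > 0, κ * t ≤ 1 :=
    ⟨1 / (t + 1), by positivity, by rw [div_mul_eq_mul_div, div_le_one (by linarith)]; linarith⟩
  have hsub : Set.Icc 0 t ⊆ Set.Ici (0 : ℝ) := fun x hx => hx.1
  let p : ℝ → ℝ := fun x => 2 / τ * (Φ (η 0) - Φ (η x) + κ * x)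
  let p' : ℝ → ℝ := fun x => 2 / τ * (- fderiv ℝ Φ (η x) (η' x) + κ * 1)
  have hp : ∀ x, 0 ≤ x → HasDerivWithinAt p (p' x) (Set.Ici x) x := fun x hx =>
    (((hasDerivWithinAt_comp_right hΦ (h x hx).1).const_sub _).add
      ((hasDerivWithinAt_id x _).const_mul κ)).const_mul _
  have hpc : ContinuousOn p (Set.Icc 0 t) :=
    continuousOn_const.mul ((continuousOn_const.sub
      (hΦ.continuous.comp_continuousOn (hcont.mono hsub))).add (by fun_prop))
  have hp0 : ∀ x, 0 ≤ x → 0 ≤ p x := fun x hx => by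
    have := hmono le_rfl hx
    have : 0 ≤ Φ (η 0) - Φ (η x) + κ * x := by nlinarith
    positivity
  have key := image_norm_le_of_norm_deriv_right_lt_deriv_boundary' (f := η)
    (f' := η') (a := 0) (b := t) (hcont.mono hsub) (fun x hx => (h x hx.1).1)
    (B := fun x => (1 + R) * Real.exp (p x) - 1)
    (B' := fun x => (1 + R) * (Real.exp (p x) * p' x)) (by simpa [p] using h0)
    ((continuousOn_const.mul hpc.rexp).sub continuousOn_const)
    (fun x hx => ((hp x hx.1).exp.const_mul _).sub_const _) (fun x hx heq => by
      have hexp : 1 ≤ Real.exp (p x) := Real.one_le_exp (hp0 x hx.1)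
      have hg := hfar x hx.1 (by rw [heq]; nlinarith)
      have hd := (h x hx.1).2
      have hN : 1 + ‖η x‖ = (1 + R) * Real.exp (p x) := by rw [heq]; ring
      have hNpos : 0 < 1 + ‖η x‖ := by positivity
      rw [← mul_assoc, ← hN]
      have h1 : 1 / 2 * τ * ‖η' x‖
          ≤ (1 + ‖η x‖) * (1 / 2 * ‖fderiv ℝ Φ (η x)‖ * ‖η' x‖) := by
        have := mul_le_mul_of_nonneg_right hg (norm_nonneg (η' x))
        linarith
      have h2 : 1 / 2 * τ * ‖η' x‖ < (1 + ‖η x‖) * (- fderiv ℝ Φ (η x) (η' x) + κ * 1) := by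
        have := mul_le_mul_of_nonneg_left hd hNpos.le
        have : 0 < (1 + ‖η x‖) * κ := by positivity
        linarith
      have h3 : 2 / τ * (1 / 2 * τ * ‖η' x‖)
          < 2 / τ * ((1 + ‖η x‖) * (- fderiv ℝ Φ (η x) (η' x) + κ * 1)) := by gcongr
      have e : 2 / τ * (1 / 2 * τ * ‖η' x‖) = ‖η' x‖ := by field_simp
      simp only [p']
      linarith) ⟨ht, le_rfl⟩
  have hpt : p t ≤ 2 / τ * (β + 1) := by
    simp only [p]
    gcongr
    exact hβ t ht
  have : (1 + R) * Real.exp (p t) ≤ (1 + R) * Real.exp (2 / τ * (β + 1)) := by gcongr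
  linarith

/-- Discreteness of Cerami sequences forces a definite drop of `Φ` along every displacement of a
bounded descent curve, uniformly over all such curves. -/
lemma exists_uniform_drop (hΦ : Differentiable ℝ Φ) {β δ R ε : ℝ}
    (hdisc : ∀ u v : ℕ → E, IsCeramiIn Φ β u → IsCeramiIn Φ β v → (∀ n, ‖u n - v n‖ < δ) →
      ∀ ε > 0, ∃ n, ‖u n - v n‖ < ε) (hε : 0 < ε) (hεδ : ε < δ) :
    ∃ μ > 0, ∀ η : ℝ → E, IsDescentCurve Φ η →
      (∀ t, 0 ≤ t → (0 ≤ Φ (η t) ∧ Φ (η t) ≤ β) ∧ ‖η t‖ ≤ R) →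
      ∀ s t, 0 ≤ s → s ≤ t → ε ≤ ‖η t - η s‖ → μ ≤ Φ (η s) - Φ (η t) := by
  by_contra! hcon
  have key : ∀ n : ℕ, ∃ x y : E, (0 ≤ Φ x ∧ Φ x ≤ β) ∧ (0 ≤ Φ y ∧ Φ y ≤ β) ∧
      (1 + ‖x‖) * ‖fderiv ℝ Φ x‖ ≤ (1 + R) * (1 / (n + 1)) ∧
      (1 + ‖y‖) * ‖fderiv ℝ Φ y‖ ≤ (1 + R) * (1 / (n + 1)) ∧
      ‖x - y‖ < δ ∧ ε / 3 ≤ ‖x - y‖ := by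
    intro n
    have hn : (0 : ℝ) < 1 / (n + 1) := by positivity
    obtain ⟨η, hη, hb, s, t, hs, hst, hmove, hdrop⟩ :=
      hcon (1 / ((n : ℝ) + 1) * (ε / 6) / 2) (by positivity)
    -- an intermediate time at which two thirds of the displacement are reached
    obtain ⟨t₂, ht₂, hmid⟩ : ∃ t₂ ∈ Set.Icc s t, ‖η t₂ - η s‖ = 2 * ε / 3 := by
      have hc : ContinuousOn (fun x => ‖η x - η s‖) (Set.Icc s t) :=
        ((hη.1.mono fun x hx => hs.trans hx.1).sub continuousOn_const).norm
      have := intermediate_value_Icc hst hc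
      exact this ⟨by simp only [sub_self, norm_zero]; positivity, by linarith⟩
    have hmove₂ : ε / 3 ≤ ‖η t - η t₂‖ := by
      have := norm_sub_le_norm_sub_add_norm_sub (η t) (η t₂) (η s)
      linarith
    have hdrop₂ : Φ (η t₂) - Φ (η t) < 1 / ((n : ℝ) + 1) * (ε / 6) / 2 := by
      have := hη.le hΦ hs ht₂.1
      linarith
    obtain ⟨x, hx, hx1, hx2⟩ := hη.exists_small_fderiv hΦ hs hst hn
      (show ε / 6 < _ by linarith) hdrop
    obtain ⟨y, hy, hy1, hy2⟩ := hη.exists_small_fderiv hΦ (hs.trans ht₂.1) ht₂.2 hn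
      (show ε / 6 < _ by linarith) hdrop₂
    have hx0 := hb x (hs.trans hx.1)
    have hy0 := hb y (hs.trans (ht₂.1.trans hy.1))
    have hR : 0 ≤ 1 + R := by linarith [norm_nonneg (η x)]
    refine ⟨η x, η y, hx0.1, hy0.1, ?_, ?_, ?_, ?_⟩
    · gcongr; exact hx0.2
    · gcongr; exact hy0.2
    · have h1 := norm_sub_le_norm_sub_add_norm_sub (η x) (η s) (η y)
      have h2 := norm_sub_le_norm_sub_add_norm_sub (η s) (η t₂) (η y)
      rw [norm_sub_rev (η s) (η t₂)] at h2
      rw [norm_sub_rev (η t₂) (η y)] at h2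
      linarith
    · have h1 := norm_sub_le_norm_sub_add_norm_sub (η t₂) (η x) (η s)
      have h2 := norm_sub_le_norm_sub_add_norm_sub (η t₂) (η y) (η x)
      rw [norm_sub_rev (η t₂) (η y)] at h2
      rw [norm_sub_rev (η y) (η x)] at h2
      linarith
  choose x y hx hy hx' hy' hlt hge using key
  have hlim : Tendsto (fun n : ℕ => (1 + R) * (1 / ((n : ℝ) + 1))) atTop (𝓝 0) := by
    simpa using tendsto_one_div_add_atTop_nhds_zero_nat.const_mul (1 + R)
  obtain ⟨n, hn⟩ := hdisc x y ⟨hx, squeeze_zero (fun n => by positivity) hx' hlim⟩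
    ⟨hy, squeeze_zero (fun n => by positivity) hy' hlim⟩ hlt (ε / 3) (by positivity)
  exact absurd hn (not_lt.2 (hge n))

/-- At the limit of a solution of `η' = W(η)` along which `Φ` is bounded below, `Φ` does not
decrease along `W`. -/
lemma fderiv_nonneg_of_tendsto (hΦ : ContDiff ℝ 1 Φ) {W : E → E} (hW : Continuous W)
    (hη : IsForwardSolution W η) {ℓ : E} (hℓ : Tendsto η atTop (𝓝 ℓ))
    (hnn : ∀ t, 0 ≤ t → 0 ≤ Φ (η t)) : 0 ≤ fderiv ℝ Φ ℓ (W ℓ) := by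
  by_contra! hneg
  have hd : Differentiable ℝ Φ := hΦ.differentiable one_ne_zero
  have hc : Continuous fun x => fderiv ℝ Φ x (W x) :=
    (hΦ.continuous_fderiv one_ne_zero).clm_apply hW
  set c := fderiv ℝ Φ ℓ (W ℓ) / 2 with hcdef
  have hev : ∀ᶠ t in atTop, fderiv ℝ Φ (η t) (W (η t)) < c :=
    ((hc.tendsto ℓ).comp hℓ).eventually_lt_const (by linarith)
  obtain ⟨T₀, hT₀⟩ := eventually_atTop.1 hev
  set T := max T₀ 0
  have hT : 0 ≤ T := le_max_right _ _
  have hle : ∀ t, T ≤ t → Φ (η t) ≤ Φ (η T) + c * (t - T) := by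
    intro t ht
    refine image_le_of_deriv_right_le_deriv_boundary (f := fun x => Φ (η x)) (a := T) (b := t)
      (hd.continuous.comp_continuousOn (hη.1.mono fun x hx => hT.trans hx.1))
      (fun x hx => hasDerivWithinAt_comp_right hd (hη.2 x (hT.trans hx.1))) (by simp)
      (B := fun x => Φ (η T) + c * (x - T)) (B' := fun _ => c * 1) (by fun_prop)
      (fun x _ => (((hasDerivWithinAt_id x _).sub_const T).const_mul c).const_add _)
      (fun x hx => ?_) ⟨ht, le_rfl⟩
    rw [mul_one]
    exact (hT₀ x ((le_max_left _ _).trans hx.1)).le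
  have hcn : c < 0 := by linarith
  have h1 := hle (T + (Φ (η T) + 1) / (-c)) (by
    have := hnn T hT
    have : 0 ≤ (Φ (η T) + 1) / (-c) := div_nonneg (by linarith) (by linarith)
    linarith)
  have h2 := hnn (T + (Φ (η T) + 1) / (-c)) (by
    have := hnn T hT
    have : 0 ≤ (Φ (η T) + 1) / (-c) := div_nonneg (by linarith) (by linarith)
    linarith)
  have e : c * (T + (Φ (η T) + 1) / (-c) - T) = -(Φ (η T) + 1) := by
    have := hcn.ne
    field_simp
    ring
  linarith

end Descent

/-! ### Odd functions separating points of different types -/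

/-- A closed symmetric set `Y` carries `card 𝓛` odd functions without common zero if its points have
an even level `lev` in the finite set `𝓛` and an odd sign `σ` such that, on a closed neighbourhood
`D d` of the level set `{lev = d}` in `{lev ≤ d}`, the sign is locally constant. The functions are
built from the highest level downwards. -/
lemma exists_odd_functions {F : Type*} [NormedAddCommGroup F] {Z : Set F}
    {lev : F → ℝ} {σ : F → ZMod 2} (hσ : ∀ c ∈ Z, σ (-c) = σ c + 1) {D : ℝ → Set F}
    (hDclosed : ∀ d, IsClosed (D d)) (hDneg : ∀ d, ∀ c ∈ D d, -c ∈ D d)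
    (hDlev : ∀ c ∈ Z, c ∈ D (lev c))
    (hloc : ∀ d, ∀ c₀ ∈ Z, c₀ ∈ D d → lev c₀ ≤ d →
      ∀ᶠ c in 𝓝 c₀, c ∈ Z → c ∈ D d → lev c ≤ d → σ c = σ c₀) (𝓛 : Finset ℝ) :
    ∀ Y ⊆ Z, IsClosed Y → (∀ c ∈ Y, -c ∈ Y) → (∀ c ∈ Y, lev c ∈ 𝓛) →
      ∃ L : List (F → ℝ), L.length = 𝓛.card ∧ (∀ f ∈ L, Continuous f) ∧
        (∀ f ∈ L, ∀ c, f (-c) = - f c) ∧ ∀ c ∈ Y, ∃ f ∈ L, f c ≠ 0 := by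
  induction 𝓛 using Finset.induction_on_max with
  | empty =>
    exact fun Y _ _ _ hlev => ⟨[], rfl, by simp, by simp, fun c hc => by simpa using hlev c hc⟩
  | insert d 𝓛 hmax ih =>
    intro Y hYZ hY hYneg hlev
    have hle : ∀ c ∈ Y, lev c ≤ d := fun c hc => by
      rcases Finset.mem_insert.1 (hlev c hc) with h | h
      · exact h.le
      · exact (hmax _ h).le
    let P : Set F := {c | c ∈ Y ∧ c ∈ D d ∧ σ c = 1}
    let Q : Set F := {c | -c ∈ P}
    have hP : IsClosed P := by
      refine isClosed_of_closure_subset fun c hc => ?_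
      have hcY : c ∈ Y := hY.closure_subset_iff.2 (fun x hx => hx.1) hc
      have hcD : c ∈ D d := (hDclosed d).closure_subset_iff.2 (fun x hx => hx.2.1) hc
      obtain ⟨x, hx, hxP⟩ := ((mem_closure_iff_frequently.1 hc).and_eventually
        (hloc d c (hYZ hcY) hcD (hle c hcY))).exists
      exact ⟨hcY, hcD, (hxP (hYZ hx.1) hx.2.1 (hle x hx.1)).symm.trans hx.2.2⟩
    have hQ : IsClosed Q := hP.preimage continuous_neg
    have hQeq : Q = (fun c => -c) '' P := by
      ext c
      exact ⟨fun h => ⟨-c, h, neg_neg c⟩, by rintro ⟨x, hx, rfl⟩; simpa [Q] using hx⟩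
    have hPeq : P = (fun c => -c) '' Q := by
      ext c
      exact ⟨fun h => ⟨-c, by simpa [Q] using h, neg_neg c⟩, by rintro ⟨x, hx, rfl⟩; exact hx⟩
    have hneg1 : ∀ c, Metric.infDist (-c) P = Metric.infDist c Q := fun c => by
      rw [hPeq]; exact Metric.infDist_image isometry_neg
    have hneg2 : ∀ c, Metric.infDist (-c) Q = Metric.infDist c P := fun c => by
      rw [hQeq]; exact Metric.infDist_image isometry_neg
    let f : F → ℝ := fun c => Metric.infDist c Q - Metric.infDist c P
    have hfc : Continuous f := (Metric.continuous_infDist_pt _).sub (Metric.continuous_infDist_pt _)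
    have hfo : ∀ c, f (-c) = - f c := fun c => by simp only [f, hneg1, hneg2]; ring
    have hfP : ∀ c ∈ P, f c ≠ 0 := fun c hc => by
      have hcQ : c ∉ Q := fun h => by
        have h1 := hσ c (hYZ hc.1)
        rw [h.2.2, hc.2.2] at h1
        exact absurd h1 (by decide)
      have h1 : 0 < Metric.infDist c Q :=
        (hQ.notMem_iff_infDist_pos ⟨-c, by simpa [Q] using hc⟩).1 hcQ
      simp only [f, Metric.infDist_zero_of_mem hc, sub_zero]
      exact h1.ne'
    have hfD : ∀ c ∈ Y, c ∈ D d → f c ≠ 0 := fun c hc hcD => by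
      by_cases h : σ c = 1
      · exact hfP c ⟨hc, hcD, h⟩
      · have h0 : σ c = 0 := by
          generalize σ c = x at h
          revert h
          revert x
          decide
        have := hfP (-c) ⟨hYneg c hc, hDneg d c hcD, by rw [hσ c (hYZ hc), h0, zero_add]⟩
        rwa [hfo, neg_ne_zero] at this
    obtain ⟨L, hL1, hL2, hL3, hL4⟩ := ih {c | c ∈ Y ∧ f c = 0} (fun c hc => hYZ hc.1)
      (hY.inter (isClosed_eq hfc continuous_const))
      (fun c hc => ⟨hYneg c hc.1, by rw [hfo, hc.2, neg_zero]⟩) (fun c hc => by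
        rcases Finset.mem_insert.1 (hlev c hc.1) with h | h
        · exact absurd hc.2 (hfD c hc.1 (h ▸ hDlev c (hYZ hc.1)))
        · exact h)
    refine ⟨f :: L, ?_, ?_, ?_, fun c hc => ?_⟩
    · rw [List.length_cons, hL1, Finset.card_insert_of_notMem fun h => (hmax d h).false]
    · simpa using ⟨hfc, hL2⟩
    · intro g hg
      rcases List.mem_cons.1 hg with rfl | hg
      · exact hfo
      · exact hL3 g hg
    · by_cases h : f c = 0
      · obtain ⟨g, hg, hgc⟩ := hL4 c ⟨hc, h⟩
        exact ⟨g, List.mem_cons_of_mem _ hg, hgc⟩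
      · exact ⟨f, List.mem_cons_self, h⟩

/-! ### Finitely many critical orbits are impossible for an even functional -/

section Abstract

variable {E : Type*} [NormedAddCommGroup E] [NormedSpace ℝ E] {Φ : E → ℝ}

lemma fderiv_neg_of_even (hd : Differentiable ℝ Φ) (heven : ∀ x, Φ (-x) = Φ x) (x : E) :
    fderiv ℝ Φ (-x) = - fderiv ℝ Φ x := by
  have h : HasFDerivAt (fun y => Φ (-y)) ((fderiv ℝ Φ (-x)).comp (-ContinuousLinearMap.id ℝ E)) x :=
    (hd (-x)).hasFDerivAt.comp x (hasFDerivAt_id x).neg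
  rw [funext heven] at h
  rw [h.fderiv]
  ext v
  simp

/-- An even functional has an odd descending semiflow whose convergent trajectories end in a
prescribed neighbourhood `O` of the critical set. -/
lemma exists_descent_flow [CompleteSpace E] [Nontrivial E] (hΦ : ContDiff ℝ 1 Φ)
    (heven : ∀ x, Φ (-x) = Φ x) {O : Set E} (hO : IsOpen O)
    (hcrit : ∀ x, fderiv ℝ Φ x = 0 → x ∈ O) :
    ∃ η : E → ℝ → E, (∀ x, η x 0 = x) ∧ (∀ t, 0 ≤ t → Continuous fun x => η x t) ∧
      (∀ x t, 0 ≤ t → η (-x) t = - η x t) ∧ (∀ x, IsDescentCurve Φ (η x)) ∧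
      ∀ x ℓ, Tendsto (η x) atTop (𝓝 ℓ) → (∀ t, 0 ≤ t → 0 ≤ Φ (η x t)) → ℓ ∈ O := by
  obtain ⟨V, hlip, hV1, hVodd, hVg, hVpos⟩ := exists_lipschitz_pseudogradient
    (hΦ.continuous_fderiv one_ne_zero)
    (fderiv_neg_of_even (hΦ.differentiable one_ne_zero) heven) hO hcrit
  have hW : LipschitzWith 2 (fun x => - V x) := hlip.neg
  choose η h0 hη using exists_forwardSolution hW (fun x => by simpa using hV1 x)
  refine ⟨η, h0, fun t ht => ?_, fun x t ht => ?_, fun x => ⟨(hη x).1, fun t => - V (η x t),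
    fun t ht => ⟨(hη x).2 t ht, by simpa using hVg (η x t)⟩⟩, fun x ℓ hℓ hnn => ?_⟩
  · refine (LipschitzWith.of_dist_le_mul (K := (Real.exp (2 * t)).toNNReal)
      fun x y => ?_).continuous
    have := (hη x).dist_le hW (hη y) ht
    rw [h0, h0] at this
    rw [Real.coe_toNNReal _ (Real.exp_pos _).le, mul_comm]
    exact this
  · refine (hη (-x)).eq hW (ζ := fun t => - η x t) ⟨(hη x).1.neg, fun s hs => ?_⟩
      (by rw [h0, h0]) ht
    have := ((hη x).2 s hs).neg
    simp only [hVodd]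
    exact this
  · by_contra hnot
    have h1 := fderiv_nonneg_of_tendsto hΦ hW.continuous (hη x) hℓ hnn
    have h2 := hVpos ℓ hnot
    rw [map_neg] at h1
    linarith

/-- The basin of the component of `{Φ < a}` inside the sphere of radius `r`: a trajectory whose
starting point lies on the frontier of this basin stays in `{a ≤ Φ}` forever. Here `ι` parametrizes
the starting points. -/
lemma le_of_mem_frontier_basin {F : Type*} [TopologicalSpace F] {ι : F → E} (hι : Continuous ι)
    (hΦ : Differentiable ℝ Φ) {r a : ℝ} (hsphere : ∀ x, ‖x‖ = r → a ≤ Φ x) {η : E → ℝ → E}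
    (hcont : ∀ t, 0 ≤ t → Continuous fun x => η x t) (hdesc : ∀ x, IsDescentCurve Φ (η x)) {z : F}
    (hz : z ∈ frontier {c | ∃ t, 0 ≤ t ∧ ‖η (ι c) t‖ < r ∧ Φ (η (ι c) t) < a}) {t : ℝ}
    (ht : 0 ≤ t) : a ≤ Φ (η (ι z) t) := by
  have hopen : ∀ s, 0 ≤ s → IsOpen {c | ‖η (ι c) s‖ < r ∧ Φ (η (ι c) s) < a} := fun s hs =>
    (isOpen_lt ((hcont s hs).comp hι).norm continuous_const).inter
      (isOpen_lt (hΦ.continuous.comp ((hcont s hs).comp hι)) continuous_const)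
  have hopen' : ∀ s, 0 ≤ s → IsOpen {c | r < ‖η (ι c) s‖ ∧ Φ (η (ι c) s) < a} := fun s hs =>
    (isOpen_lt continuous_const ((hcont s hs).comp hι).norm).inter
      (isOpen_lt (hΦ.continuous.comp ((hcont s hs).comp hι)) continuous_const)
  set A := {c | ∃ t, 0 ≤ t ∧ ‖η (ι c) t‖ < r ∧ Φ (η (ι c) t) < a} with hAdef
  have hA : IsOpen A := by
    rw [isOpen_iff_mem_nhds]
    rintro c ⟨s, hs, hc⟩
    exact mem_of_superset ((hopen s hs).mem_nhds hc) fun c' hc' => ⟨s, hs, hc'⟩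
  -- below the level `a` a trajectory cannot cross the sphere of radius `r`
  have hcross : ∀ x s s', 0 ≤ s → 0 ≤ s' → ‖η x s‖ < r → Φ (η x s) < a → r < ‖η x s'‖ →
      Φ (η x s') < a → False := by
    intro x s s' hs hs' h1 h2 h3 h4
    have hm : 0 ≤ min s s' := le_min hs hs'
    have hc : ContinuousOn (fun u => ‖η x u‖) (Set.uIcc s s') :=
      ((hdesc x).1.mono fun u hu => hm.trans hu.1).norm
    obtain ⟨u, hu, hur⟩ := intermediate_value_uIcc hc
      (show r ∈ Set.uIcc ‖η x s‖ ‖η x s'‖ from Set.mem_uIcc_of_le h1.le h3.le)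
    have h5 := hsphere _ hur
    have h6 := (hdesc x).le hΦ hm hu.1
    rcases min_choice s s' with h | h <;> rw [h] at h6 <;> linarith
  rw [hA.frontier_eq] at hz
  by_contra! hlt
  rcases lt_trichotomy ‖η (ι z) t‖ r with h | h | h
  · exact hz.2 ⟨t, ht, h, hlt⟩
  · exact absurd (hsphere _ h) (not_le.2 hlt)
  · obtain ⟨c, hc, s, hs, hcs⟩ := mem_closure_iff_nhds.1 hz.1 _ ((hopen' t ht).mem_nhds ⟨h, hlt⟩)
    exact hcross _ s t hs ht hcs.1 hcs.2 hc.1 hc.2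

/-- An even functional of mountain pass type on an infinite-dimensional Banach space, whose Cerami
sequences are bounded and discrete, cannot have a uniformly discrete critical set with finitely
many critical values. -/
theorem false_of_finite_critical_values [CompleteSpace E] (hΦ : ContDiff ℝ 1 Φ)
    (heven : ∀ x, Φ (-x) = Φ x) (h0 : Φ 0 = 0) {r a : ℝ} (hr : 0 < r) (ha : 0 < a)
    (hsphere : ∀ x, ‖x‖ = r → a ≤ Φ x)
    (hfar : ∀ k : ℕ, ∃ e : Fin k → E, ∃ L > 0, ∀ c : Fin k → ℝ, (∃ i, L ≤ |c i|) →
      Φ (∑ i, c i • e i) < 0 ∧ r < ‖∑ i, c i • e i‖)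
    {κ : ℝ} (hκ : 0 < κ)
    (hsep : ∀ w w', fderiv ℝ Φ w = 0 → fderiv ℝ Φ w' = 0 → w ≠ w' → κ ≤ ‖w - w'‖)
    (hunif : ∀ ε > 0, ∃ ρ > 0, ∀ w, fderiv ℝ Φ w = 0 → ∀ x, ‖x - w‖ < ρ → |Φ x - Φ w| < ε)
    (hfin : (Φ '' {w | fderiv ℝ Φ w = 0}).Finite)
    (hbdd : ∀ β > 0, ∃ C, ∀ u, IsCeramiIn Φ β u → ∃ n, ‖u n‖ < C)
    (hdisc : ∀ β > 0, ∃ δ > 0, ∀ u v, IsCeramiIn Φ β u → IsCeramiIn Φ β v →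
      (∀ n, ‖u n - v n‖ < δ) → ∀ ε > 0, ∃ n, ‖u n - v n‖ < ε) : False := by
  have hd : Differentiable ℝ Φ := hΦ.differentiable one_ne_zero
  set 𝓛 : Finset ℝ := hfin.toFinset with h𝓛
  obtain ⟨e, L, hL, hneg⟩ := hfar (𝓛.card + 1)
  let ι : (Fin (𝓛.card + 1) → ℝ) → E := fun c => ∑ i, c i • e i
  have hι : Continuous ι := by fun_prop
  have hιneg : ∀ c, ι (-c) = - ι c := fun c => by simp [ι]
  have hι0 : ι 0 = 0 := by simp [ι]
  have : Nontrivial E := ⟨ι (fun _ => L), 0, fun h => by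
    have := (hneg (fun _ => L) ⟨0, le_abs_self L⟩).2
    rw [show ∑ i, L • e i = 0 from h, norm_zero] at this
    linarith⟩
  -- bounds on the compact cube of starting points
  let Q : Set (Fin (𝓛.card + 1) → ℝ) := Set.Icc (fun _ => -L) (fun _ => L)
  have hQ : IsCompact Q := isCompact_Icc
  obtain ⟨β₀, hβ₀⟩ := hQ.bddAbove_image (hd.continuous.comp hι).continuousOn
  obtain ⟨R₀, hR₀⟩ := hQ.bddAbove_image hι.norm.continuousOn
  set β := max β₀ 1
  have hβ : 0 < β := lt_max_of_lt_right one_pos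
  obtain ⟨C, hC⟩ := hbdd β hβ
  obtain ⟨δ, hδ, hδdisc⟩ := hdisc β hβ
  set R := max R₀ C
  -- outside the ball of radius `C` the weighted derivative is bounded below
  obtain ⟨τ, hτ, hτC⟩ : ∃ τ > 0, ∀ x, 0 ≤ Φ x → Φ x ≤ β → C ≤ ‖x‖ →
      τ ≤ (1 + ‖x‖) * ‖fderiv ℝ Φ x‖ := by
    by_contra! hcon
    choose u hu0 huβ huC hu using fun n : ℕ => hcon (1 / ((n : ℝ) + 1)) (by positivity)
    obtain ⟨n, hn⟩ := hC u ⟨fun n => ⟨hu0 n, huβ n⟩, squeeze_zero (fun n => by positivity)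
      (fun n => (hu n).le) tendsto_one_div_add_atTop_nhds_zero_nat⟩
    exact absurd hn (not_lt.2 (huC n))
  set R₁ := (1 + R) * Real.exp (2 / τ * (β + 1))
  -- the scale `ε₀` of displacements and the drop `μ` that it costs
  set ε₀ := min (δ / 2) (κ / 8)
  have hε₀ : 0 < ε₀ := lt_min (by linarith) (by linarith)
  have hdrop := fun ε hε hεδ => exists_uniform_drop (R := R₁) hd hδdisc (ε := ε) hε hεδ
  obtain ⟨μ, hμ, hμdrop⟩ := hdrop ε₀ hε₀ ((min_le_left _ _).trans_lt (by linarith))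
  set ε' := min (μ / 4) (a / 2)
  have hε' : 0 < ε' := lt_min (by linarith) (by linarith)
  obtain ⟨ρ₀, hρ₀, hρ₀Φ⟩ := hunif ε' hε'
  set ρ := min ρ₀ (κ / 8)
  have hρ : 0 < ρ := lt_min hρ₀ (by linarith)
  let O : Set E := {x | ∃ w, fderiv ℝ Φ w = 0 ∧ ‖x - w‖ < ρ}
  have hO : IsOpen O := by
    have : O = ⋃ w ∈ {w | fderiv ℝ Φ w = 0}, Metric.ball w ρ := by
      ext x; simp [O, dist_eq_norm]
    rw [this]
    exact isOpen_biUnion fun w _ => Metric.isOpen_ball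
  obtain ⟨η, hη0, hηc, hηneg, hηd, hηlim⟩ := exists_descent_flow hΦ heven hO
    (fun x hx => ⟨x, hx, by simpa using hρ⟩)
  -- the starting points whose trajectories stay in `{a ≤ Φ}`
  let Z : Set (Fin (𝓛.card + 1) → ℝ) := {c | c ∈ Q ∧ ∀ t, 0 ≤ t → a ≤ Φ (η (ι c) t)}
  have hQneg : ∀ c ∈ Q, -c ∈ Q := fun c hc =>
    ⟨fun i => neg_le_neg (hc.2 i), fun i => by simpa using neg_le_neg (hc.1 i)⟩
  have hΦneg : ∀ c t, 0 ≤ t → Φ (η (ι (-c)) t) = Φ (η (ι c) t) := fun c t ht => by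
    rw [hιneg, hηneg _ _ ht, heven]
  have hZneg : ∀ c ∈ Z, -c ∈ Z := fun c hc =>
    ⟨hQneg c hc.1, fun t ht => by rw [hΦneg c t ht]; exact hc.2 t ht⟩
  have hclosed : ∀ d, IsClosed {c | ∀ t, 0 ≤ t → d ≤ Φ (η (ι c) t)} := fun d => by
    simp only [Set.ofPred_forall]
    exact isClosed_iInter fun t => isClosed_iInter fun ht =>
      isClosed_le continuous_const (hd.continuous.comp ((hηc t ht).comp hι))
  have hZclosed : IsClosed Z := isClosed_Icc.inter (hclosed a)
  -- these trajectories are bounded, their levels are between `0` and `β`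
  have hZb : ∀ c ∈ Z, ∀ t, 0 ≤ t → (0 ≤ Φ (η (ι c) t) ∧ Φ (η (ι c) t) ≤ β) ∧
      ‖η (ι c) t‖ ≤ R₁ := by
    intro c hc
    have h1 : ∀ t, 0 ≤ t → 0 ≤ Φ (η (ι c) t) := fun t ht => ha.le.trans (hc.2 t ht)
    have h3 : Φ (η (ι c) 0) ≤ β := by
      rw [hη0]; exact (hβ₀ ⟨c, hc.1, rfl⟩).trans (le_max_left _ _)
    have h2 : ∀ t, 0 ≤ t → Φ (η (ι c) t) ≤ β := fun t ht =>
      ((hηd (ι c)).le hd le_rfl ht).trans h3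
    refine fun t ht => ⟨⟨h1 t ht, h2 t ht⟩, (hηd (ι c)).norm_le hd hτ ?_ (fun s hs => ?_)
      (fun s hs hR => hτC _ (h1 s hs) (h2 s hs) ((le_max_right _ _).trans hR)) ht⟩
    · rw [hη0]; exact (hR₀ ⟨c, hc.1, rfl⟩).trans (le_max_left _ _)
    · linarith [h1 s hs]
  have hlim : ∀ c, ∃ ℓ w, c ∈ Z → Tendsto (η (ι c)) atTop (𝓝 ℓ) ∧ fderiv ℝ Φ w = 0 ∧
      ‖ℓ - w‖ < ρ := by
    intro c
    by_cases hc : c ∈ Z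
    · obtain ⟨ℓ, hℓ⟩ := exists_tendsto_of_drop hδ (fun t ht => (hZb c hc t ht).1.1)
        (fun ε hε hεδ => by
          obtain ⟨μ, hμ, h⟩ := hdrop ε hε hεδ
          exact ⟨μ, hμ, h _ (hηd (ι c)) (hZb c hc)⟩)
      obtain ⟨w, hw, hℓw⟩ := hηlim _ ℓ hℓ (fun t ht => (hZb c hc t ht).1.1)
      exact ⟨ℓ, w, fun _ => ⟨hℓ, hw, hℓw⟩⟩
    · exact ⟨0, 0, fun h => absurd h hc⟩
  choose ℓ w hℓw using hlim
  have hρκ : ρ ≤ κ / 8 := min_le_right _ _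
  have hΦℓ : ∀ c ∈ Z, |Φ (ℓ c) - Φ (w c)| < ε' := fun c hc =>
    hρ₀Φ _ (hℓw c hc).2.1 _ ((hℓw c hc).2.2.trans_le (min_le_left _ _))
  have hΦlim : ∀ c ∈ Z, Tendsto (fun t => Φ (η (ι c) t)) atTop (𝓝 (Φ (ℓ c))) := fun c hc =>
    (hd.continuous.tendsto _).comp (hℓw c hc).1
  have hΦge : ∀ c ∈ Z, ∀ t, 0 ≤ t → Φ (ℓ c) ≤ Φ (η (ι c) t) := fun c hc t ht =>
    le_of_tendsto (hΦlim c hc) (eventually_atTop.2 ⟨t, fun s hs => (hηd (ι c)).le hd ht hs⟩)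
  have hwneg : ∀ c ∈ Z, w (-c) = - w c := by
    intro c hc
    have hlneg : ℓ (-c) = - ℓ c := by
      refine tendsto_nhds_unique (hℓw _ (hZneg c hc)).1 ?_
      refine (hℓw c hc).1.neg.congr' ?_
      filter_upwards [eventually_ge_atTop 0] with t ht
      rw [hιneg, hηneg _ _ ht]
    by_contra hne
    have h1 := hsep _ _ (hℓw _ (hZneg c hc)).2.1
      (by rw [fderiv_neg_of_even hd heven, (hℓw c hc).2.1, neg_zero] : fderiv ℝ Φ (- w c) = 0) hne
    have h2 := (hℓw _ (hZneg c hc)).2.2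
    have h3 := (hℓw c hc).2.2
    have h4 : w (-c) - -w c = -(ℓ (-c) - w (-c)) - (ℓ c - w c) := by rw [hlneg]; abel
    have h5 := norm_sub_le (-(ℓ (-c) - w (-c))) (ℓ c - w c)
    rw [norm_neg, ← h4] at h5
    linarith
  have hw0 : ∀ c ∈ Z, w c ≠ 0 := by
    intro c hc h
    have h1 := hΦℓ c hc
    rw [h, h0, sub_zero] at h1
    have h2 : a ≤ Φ (ℓ c) := ge_of_tendsto (hΦlim c hc)
      (eventually_atTop.2 ⟨0, fun t ht => hc.2 t ht⟩)
    have h3 : ε' ≤ a / 2 := min_le_right _ _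
    linarith [le_abs_self (Φ (ℓ c))]
  obtain ⟨σ, hσ⟩ : ∃ s : E → ZMod 2, ∀ x, x ≠ 0 → s (-x) = s x + 1 := by
    have := IsAddTorsionFree.of_isTorsionFree ℝ E
    exact exists_odd_sign E
  obtain ⟨F, hFlen, hFc, hFodd, hFne⟩ := exists_odd_functions (Z := Z) (lev := fun c => Φ (w c))
    (σ := fun c => σ (w c)) (fun c hc => by rw [hwneg c hc, hσ _ (hw0 c hc)])
    (D := fun d => {c | ∀ t, 0 ≤ t → d - ε' ≤ Φ (η (ι c) t)}) (fun d => hclosed _)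
    (fun d c hc t ht => by rw [hΦneg c t ht]; exact hc t ht)
    (fun c hc t ht => by
      have h1 := (abs_lt.1 (hΦℓ c hc)).1
      have h2 := hΦge c hc t ht
      show Φ (w c) - ε' ≤ _
      linarith)
    (by
      intro d c₀ hc₀ hD₀ hlev₀
      -- a time at which the trajectory of `c₀` has almost reached its final level
      have h1 : Φ (ℓ c₀) < d + ε' := by linarith [(abs_lt.1 (hΦℓ c₀ hc₀)).2]
      obtain ⟨t, htd, ht⟩ := (((hΦlim c₀ hc₀).eventually_lt_const h1).and
        (eventually_ge_atTop 0)).exists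
      have hηt : Continuous fun c => η (ι c) t := (hηc t ht).comp hι
      have hend : ∀ c ∈ Z, (∀ t, 0 ≤ t → d - ε' ≤ Φ (η (ι c) t)) → Φ (η (ι c) t) < d + ε' →
          ‖ℓ c - η (ι c) t‖ ≤ ε₀ := by
        intro c hc hD hlt
        refine le_of_tendsto ((hℓw c hc).1.sub_const _).norm
          (eventually_atTop.2 ⟨t, fun s hs => ?_⟩)
        by_contra! hgt
        have h2 := hμdrop _ (hηd (ι c)) (hZb c hc) t s ht hs hgt.le
        have h3 := hD s (ht.trans hs)
        have h4 : ε' ≤ μ / 4 := min_le_left _ _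
        linarith
      filter_upwards [(hd.continuous.comp hηt).continuousAt.eventually_lt continuousAt_const htd,
        hηt.continuousAt.eventually (Metric.ball_mem_nhds _ hε₀)] with c hlt hclose hc hD hlev
      have hww : w c = w c₀ := by
        by_contra hne
        have h2 := hsep _ _ (hℓw c hc).2.1 (hℓw c₀ hc₀).2.1 hne
        have h3 := hend c hc hD hlt
        have h4 := hend c₀ hc₀ hD₀ htd
        rw [dist_eq_norm] at hclose
        have h5 := (hℓw c hc).2.2
        have h6 := (hℓw c₀ hc₀).2.2
        have h7 : ε₀ ≤ κ / 8 := min_le_right _ _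
        have e : w c - w c₀ = -(ℓ c - w c) + (ℓ c - η (ι c) t) + (η (ι c) t - η (ι c₀) t)
          - (ℓ c₀ - η (ι c₀) t) + (ℓ c₀ - w c₀) := by abel
        have h8 : ‖w c - w c₀‖ ≤ ‖ℓ c - w c‖ + ‖ℓ c - η (ι c) t‖ + ‖η (ι c) t - η (ι c₀) t‖
            + ‖ℓ c₀ - η (ι c₀) t‖ + ‖ℓ c₀ - w c₀‖ := by
          rw [e]
          refine (norm_add_le _ _).trans (add_le_add_left ?_ _)
          refine (norm_sub_le _ _).trans (add_le_add_left ?_ _)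
          refine (norm_add_le _ _).trans (add_le_add_left ?_ _)
          refine (norm_add_le _ _).trans (add_le_add_left ?_ _)
          rw [norm_neg]
        linarith
      rw [hww]) 𝓛 Z subset_rfl hZclosed hZneg
    (fun c hc => by rw [h𝓛, Set.Finite.mem_toFinset]; exact ⟨w c, (hℓw c hc).2.1, rfl⟩)
  -- the basin of the bounded component of `{Φ < a}`
  let A : Set (Fin (𝓛.card + 1) → ℝ) :=
    {c | ∃ t, 0 ≤ t ∧ ‖η (ι c) t‖ < r ∧ Φ (η (ι c) t) < a}
  have hAL : ∀ c ∈ A, ∀ i, |c i| < L := by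
    rintro c ⟨t, ht, h1, h2⟩ i
    by_contra! hge
    obtain ⟨h3, h4⟩ := hneg c ⟨i, hge⟩
    have hc : ContinuousOn (fun u => ‖η (ι c) u‖) (Set.Icc 0 t) :=
      ((hηd (ι c)).1.mono fun u hu => hu.1).norm
    obtain ⟨u, hu, hur⟩ := intermediate_value_Icc' ht hc
      (show r ∈ Set.Icc ‖η (ι c) t‖ ‖η (ι c) 0‖ from ⟨h1.le, by rw [hη0]; exact h4.le⟩)
    have h5 := hsphere _ hur
    have h6 := (hηd (ι c)).le hd le_rfl hu.1
    rw [hη0] at h6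
    have h7 : Φ (ι c) < 0 := h3
    linarith
  obtain ⟨z, hz, hFz⟩ := exists_common_zero_on_frontier (A := A) hAL
    (fun c => by
      refine exists_congr fun t => and_congr_right fun ht => ?_
      rw [hΦneg c t ht, hιneg, hηneg _ _ ht, norm_neg])
    ⟨0, le_rfl, by rw [hη0, hι0, norm_zero]; exact hr, by rw [hη0, hι0, h0]; exact ha⟩
    F hFlen hFc hFodd
  have hzQ : z ∈ Q := closure_minimal (fun c hc => (⟨fun i => (abs_lt.1 (hAL c hc i)).1.le,
    fun i => (abs_lt.1 (hAL c hc i)).2.le⟩ : c ∈ Q)) isClosed_Icc (frontier_subset_closure hz)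
  obtain ⟨f, hf, hfz⟩ := hFne z ⟨hzQ, fun t ht =>
    le_of_mem_frontier_basin hι hd hsphere hηc hηd hz ht⟩
  exact hfz (hFz f hf)

end Abstract

/-! ### Weak sequential compactness in reflexive spaces -/

section Weak

variable {X : Type*} [NormedAddCommGroup X] [NormedSpace ℝ X]

lemma IsReflexiveSpace.exists_ultrafilter_limit (hX : IsReflexiveSpace X) {y : ℕ → X} {C : ℝ}
    (hy : ∀ n, ‖y n‖ ≤ C) (U : Ultrafilter ℕ) :
    ∃ x : X, ∀ f : StrongDual ℝ X, Tendsto (fun n => f (y n)) U (𝓝 (f x)) := by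
  let ψ : ℕ → WeakDual ℝ (StrongDual ℝ X) := fun n =>
    StrongDual.toWeakDual (NormedSpace.inclusionInDoubleDual ℝ X (y n))
  have hcpt := WeakDual.isCompact_closedBall (0 : StrongDual ℝ (StrongDual ℝ X)) C
  obtain ⟨φ, -, hφ⟩ := hcpt.ultrafilter_le_nhds (U.map ψ) (by
    rw [le_principal_iff, Ultrafilter.mem_coe, Ultrafilter.mem_map]
    refine Filter.mem_of_superset Filter.univ_mem fun n _ => ?_
    rw [Set.mem_preimage, Set.mem_preimage, mem_closedBall_zero_iff]
    exact (NormedSpace.double_dual_bound ℝ X (y n)).trans (hy n))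
  obtain ⟨x, hx⟩ := hX (WeakDual.toStrongDual φ)
  refine ⟨x, fun f => ?_⟩
  have h : Tendsto (fun n => ψ n f) U (𝓝 (φ f)) :=
    ((WeakDual.eval_continuous f).tendsto φ).comp hφ
  have e : φ f = f x := by
    have := DFunLike.congr_fun hx f
    rw [NormedSpace.dual_def] at this
    exact this.symm
  rw [e] at h
  exact h

/-- A sequence in a normed space lives in a closed subspace on which countably many functionals of
norm at most one separate points. -/
lemma exists_separating_sequence (y : ℕ → X) :
    ∃ f : ℕ → StrongDual ℝ X, (∀ j, ‖f j‖ ≤ 1) ∧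
      ∀ z ∈ (Submodule.span ℝ (Set.range y)).topologicalClosure, (∀ j, f j z = 0) → z = 0 := by
  have hsep : TopologicalSpace.IsSeparable
      ((Submodule.span ℝ (Set.range y)).topologicalClosure : Set X) := by
    rw [Submodule.topologicalClosure_coe]
    exact ((Set.countable_range y).isSeparable.span (R := ℝ)).closure
  obtain ⟨c, hc, hcl⟩ := hsep
  have hne : c.Nonempty := by
    rw [← closure_nonempty_iff]
    exact ⟨0, hcl (zero_mem _)⟩
  obtain ⟨d, rfl⟩ := hc.exists_eq_range hne
  choose f hf hfd using fun j => exists_dual_vector'' ℝ (d j)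
  refine ⟨f, hf, fun z hz hz0 => ?_⟩
  by_contra hne0
  have hpos : 0 < ‖z‖ := norm_pos_iff.2 hne0
  obtain ⟨_, ⟨j, rfl⟩, hj⟩ := Metric.mem_closure_iff.1 (hcl hz) (‖z‖ / 2) (by positivity)
  rw [dist_eq_norm] at hj
  have h1 : ‖d j‖ ≤ ‖z - d j‖ := by
    have e : f j (d j - z) = ‖d j‖ := by rw [map_sub, hz0, sub_zero]; exact hfd j
    calc ‖d j‖ = f j (d j - z) := e.symm
      _ ≤ ‖f j (d j - z)‖ := Real.le_norm_self _
      _ ≤ ‖f j‖ * ‖d j - z‖ := (f j).le_opNorm _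
      _ ≤ 1 * ‖d j - z‖ := by gcongr; exact hf j
      _ = ‖z - d j‖ := by rw [one_mul, norm_sub_rev]
  have h2 : ‖z‖ ≤ ‖z - d j‖ + ‖d j‖ := by simpa using norm_add_le (z - d j) (d j)
  linarith

/-- Bounded sequences in a reflexive space have weakly convergent subsequences. -/
lemma IsReflexiveSpace.exists_weak_subseq (hX : IsReflexiveSpace X) {y : ℕ → X} {C : ℝ}
    (hy : ∀ n, ‖y n‖ ≤ C) :
    ∃ (x : X) (φ : ℕ → ℕ), StrictMono φ ∧
      ∀ f : StrongDual ℝ X, Tendsto (fun n => f (y (φ n))) atTop (𝓝 (f x)) := by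
  obtain ⟨f, hf, hsep⟩ := exists_separating_sequence y
  set S := (Submodule.span ℝ (Set.range y)).topologicalClosure
  have hyS : ∀ n, y n ∈ S := fun n =>
    Submodule.le_topologicalClosure _ (Submodule.subset_span ⟨n, rfl⟩)
  -- a subsequence along which all the separating functionals converge
  have hcpt : IsCompact (Set.univ.pi fun _ : ℕ => Set.Icc (-C) C) :=
    isCompact_univ_pi fun _ => isCompact_Icc
  obtain ⟨c, -, φ, hφ, hc⟩ := hcpt.tendsto_subseq (x := fun n j => f j (y n)) fun n j _ => by
    have h1 : |f j (y n)| ≤ C := by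
      calc |f j (y n)| ≤ ‖f j‖ * ‖y n‖ := (f j).le_opNorm _
        _ ≤ 1 * C := by gcongr; exacts [hf j, hy n]
        _ = C := one_mul C
    exact abs_le.1 h1
  rw [tendsto_pi_nhds] at hc
  have hmem : ∀ (U : Ultrafilter ℕ) (x : X),
      (∀ g : StrongDual ℝ X, Tendsto (fun n => g (y (φ n))) U (𝓝 (g x))) → x ∈ S := by
    intro U x hx
    by_contra hnot
    obtain ⟨g, u, hg1, hg2⟩ := geometric_hahn_banach_closed_point S.convex
      (Submodule.isClosed_topologicalClosure _) hnot
    exact absurd (le_of_tendsto' (hx g) fun n => (hg1 _ (hyS (φ n))).le) (not_le.2 hg2)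
  obtain ⟨U₀, hU₀⟩ := Ultrafilter.exists_le (atTop : Filter ℕ)
  obtain ⟨x, hx⟩ := hX.exists_ultrafilter_limit (fun n => hy (φ n)) U₀
  refine ⟨x, φ, hφ, fun g => tendsto_iff_ultrafilter _ _ _ |>.2 fun U hU => ?_⟩
  obtain ⟨x', hx'⟩ := hX.exists_ultrafilter_limit (fun n => hy (φ n)) U
  have : x' - x = 0 := by
    refine hsep _ (sub_mem (hmem U x' hx') (hmem U₀ x hx)) fun j => ?_
    rw [map_sub, sub_eq_zero]
    rw [tendsto_nhds_unique (hx' (f j)) ((hc j).mono_left hU),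
      tendsto_nhds_unique (hx (f j)) ((hc j).mono_left hU₀)]
  rw [← sub_eq_zero.1 this]
  exact hx' g

end Weak

/-! ### The reduction to `X⁺` -/

namespace HilbertSplitting

variable {X : Type*} [NormedAddCommGroup X] [NormedSpace ℝ X] (D : HilbertSplitting X)

lemma plus_add_minus (x : X) : (D.plus x : X) + (D.minus x : X) = x :=
  Submodule.projection_add_projection_eq_self D.isCompl x

lemma norm_sq_eq (x : X) : ‖x‖ ^ 2 = ‖D.plus x‖ ^ 2 + ‖D.minus x‖ ^ 2 := by
  conv_lhs => rw [← D.plus_add_minus x]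
  exact D.norm_sq _ _

/-- The projection onto `X⁺` as a continuous linear map. -/
def plusL : X →L[ℝ] D.pos :=
  (D.pos.projectionOnto D.neg D.isCompl).mkContinuous 1 fun x => by
    have h := D.norm_sq_eq x
    rw [one_mul]
    exact abs_le_of_sq_le_sq' (by
      have : 0 ≤ ‖D.minus x‖ ^ 2 := by positivity
      change ‖D.plus x‖ ^ 2 ≤ _
      linarith) (norm_nonneg _) |>.2

/-- The projection onto `X⁻` as a continuous linear map. -/
def minusL : X →L[ℝ] D.neg :=
  (D.neg.projectionOnto D.pos D.isCompl.symm).mkContinuous 1 fun x => by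
    have h := D.norm_sq_eq x
    rw [one_mul]
    exact abs_le_of_sq_le_sq' (by
      have : 0 ≤ ‖D.plus x‖ ^ 2 := by positivity
      change ‖D.minus x‖ ^ 2 ≤ _
      linarith) (norm_nonneg _) |>.2

lemma plusL_apply (x : X) : D.plusL x = D.plus x := rfl

lemma plus_coe_pos (u : D.pos) : D.plus (u : X) = u :=
  Submodule.projectionOnto_apply_left D.isCompl u

lemma plus_coe_neg (v : D.neg) : D.plus (v : X) = 0 :=
  Submodule.projectionOnto_apply_right D.isCompl v

lemma plus_add (x y : X) : D.plus (x + y) = D.plus x + D.plus y := D.plusL.map_add x y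

lemma plus_neg (x : X) : D.plus (-x) = - D.plus x := D.plusL.map_neg x

lemma plus_smul (c : ℝ) (x : X) : D.plus (c • x) = c • D.plus x := D.plusL.map_smul c x

lemma isClosed_pos : IsClosed (D.pos : Set X) := by
  have : (D.pos : Set X) = D.minusL ⁻¹' {0} := by
    ext x
    exact (Submodule.projectionOnto_apply_eq_zero_iff D.isCompl.symm).symm
  rw [this]
  exact isClosed_singleton.preimage D.minusL.continuous

lemma abs_scalar_le (u v : D.pos) : |D.scalar u v| ≤ ‖u‖ * ‖v‖ := by
  have aux : ∀ u v : D.pos, D.scalar u v ≤ ‖u‖ * ‖v‖ := fun u v => by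
    have h1 := D.scalar_self (u + v)
    simp only [map_add, LinearMap.add_apply, D.scalar_self, D.scalar_comm v u] at h1
    have h2 := pow_le_pow_left₀ (norm_nonneg _) (norm_add_le u v) 2
    nlinarith
  refine abs_le.2 ⟨?_, aux u v⟩
  have := aux (-u) v
  rw [map_neg, LinearMap.neg_apply, norm_neg] at this
  linarith

/-- The scalar product of `X⁺` as a bounded bilinear map. -/
def scalarL : D.pos →L[ℝ] D.pos →L[ℝ] ℝ :=
  D.scalar.mkContinuous₂ 1 fun u v => by
    rw [one_mul]; exact D.abs_scalar_le u v

lemma scalarL_apply (u v : D.pos) : D.scalarL u v = D.scalar u v := rfl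

lemma hasFDerivAt_half_norm_sq (u : D.pos) :
    HasFDerivAt (fun u : D.pos => 1 / 2 * ‖u‖ ^ 2) (D.scalarL u) u := by
  have h := ((D.scalarL.hasFDerivAt (x := u)).clm_apply (hasFDerivAt_id u)).const_mul (1 / 2 : ℝ)
  have e : (fun u : D.pos => 1 / 2 * D.scalarL u (id u)) = fun u => 1 / 2 * ‖u‖ ^ 2 := by
    funext u
    rw [scalarL_apply, id, D.scalar_self]
  rw [e] at h
  refine h.congr_fderiv ?_
  ext v
  simp [scalarL_apply, D.scalar_comm v u]
  ring

variable {D} {I : X → ℝ}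

/-- A bounded sequence with convergent `X⁺`-parts has a `𝒯`-convergent subsequence. -/
lemma exists_tConverges_subseq (hX : IsReflexiveSpace X) {x : ℕ → X} {C : ℝ}
    (hx : ∀ n, ‖x n‖ ≤ C) {u : D.pos} (hu : Tendsto (fun n => D.plus (x n)) atTop (𝓝 u)) :
    ∃ (w : X) (φ : ℕ → ℕ), StrictMono φ ∧ D.plus w = u ∧ D.TConverges (fun n => x (φ n)) w := by
  obtain ⟨y, φ, hφ, hy⟩ := hX.exists_weak_subseq hx
  have hw : D.plus ((u : X) + (D.minus y : X)) = u := by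
    rw [plus_add, plus_coe_pos, plus_coe_neg, add_zero]
  refine ⟨(u : X) + (D.minus y : X), φ, hφ, hw, ?_, fun f => ?_⟩
  · rw [hw]
    exact hu.comp hφ.tendsto_atTop
  · have e : D.minus ((u : X) + (D.minus y : X)) = D.minus y := by
      have h1 := D.plus_add_minus ((u : X) + (D.minus y : X))
      rw [hw] at h1
      exact Subtype.ext (add_left_cancel h1)
    rw [e]
    exact hy (f.comp D.minusL)

lemma I2.le_of_tendsto (h2 : D.I2 I) {x : ℕ → X} {w : X} (hx : D.TConverges x w) {c : ℝ}
    (hc : Tendsto (fun n => I (x n)) atTop (𝓝 c)) : I w ≤ c := by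
  have h := h2 x w hx
  have hlim : Tendsto (fun n => ((I (x n) : ℝ) : EReal)) atTop (𝓝 (c : EReal)) :=
    (continuous_coe_real_ereal.tendsto c).comp hc
  rw [hlim.liminf_eq] at h
  exact EReal.coe_le_coe_iff.1 h

lemma I4.exists_bound (h4 : D.I4 I) (B : ℝ) : ∃ C, ∀ x : X, ‖D.plus x‖ + I x ≤ B → ‖x‖ ≤ C := by
  have h := eventually_comap.1 (h4.eventually (eventually_gt_atTop B))
  obtain ⟨C, hC⟩ := eventually_atTop.1 h
  refine ⟨C, fun x hx => ?_⟩
  by_contra! hlt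
  exact absurd (hC _ hlt.le x rfl) (not_lt.2 hx)

lemma J_le_J_iff {x y : X} (h : D.plus x = D.plus y) : D.J I x ≤ D.J I y ↔ I y ≤ I x := by
  simp only [J, h]
  constructor <;> intro h <;> linarith

lemma exists_isFiberMax (hX : IsReflexiveSpace X) (h1 : D.I1 I) (h2 : D.I2 I) (h4 : D.I4 I)
    (u : D.pos) : ∃ w, D.IsFiberMax I u w := by
  let S : Set ℝ := I '' {x | D.plus x = u}
  have hS : S.Nonempty := ⟨_, u, D.plus_coe_pos u, rfl⟩
  have hSb : BddBelow S := ⟨0, by rintro _ ⟨x, -, rfl⟩; exact h1.2.2 x⟩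
  obtain ⟨s, -, hs, hsS⟩ := exists_seq_tendsto_sInf hS hSb
  choose x hx hxs using hsS
  obtain ⟨B, hB⟩ := hs.bddAbove_range
  obtain ⟨C, hC⟩ := h4.exists_bound (‖u‖ + B)
  have hxu : ∀ n, D.plus (x n) = u := hx
  obtain ⟨w, φ, hφ, hwu, hw⟩ := exists_tConverges_subseq hX (x := x) (u := u) (D := D)
    (fun n => hC (x n) (by rw [hxu, hxs]; gcongr; exact hB ⟨n, rfl⟩))
    (by simp only [hxu]; exact tendsto_const_nhds)
  have hle : I w ≤ sInf S := by
    refine h2.le_of_tendsto hw ?_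
    simp only [hxs]
    exact hs.comp hφ.tendsto_atTop
  exact ⟨w, hwu, fun w' hw' => (J_le_J_iff (hw'.trans hwu.symm)).2
    (hle.trans (csInf_le hSb ⟨w', hw', rfl⟩))⟩

/-- The standing assumptions `I1`–`I5` on the functional, on a reflexive space. -/
structure Reducible (D : HilbertSplitting X) (I : X → ℝ) : Prop where
  reflexive : IsReflexiveSpace X
  i1 : D.I1 I
  i2 : D.I2 I
  i3 : D.I3 I
  i4 : D.I4 I
  i5 : D.I5 I

namespace Reducible

lemma isFiberMax_m (h : D.Reducible I) (u : D.pos) : D.IsFiberMax I u (D.m I u) :=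
  Classical.epsilon_spec (exists_isFiberMax h.reflexive h.i1 h.i2 h.i4 u)

lemma plus_m (h : D.Reducible I) (u : D.pos) : D.plus (D.m I u) = u := (h.isFiberMax_m u).1

lemma I_m_le (h : D.Reducible I) {u : D.pos} {x : X} (hx : D.plus x = u) : I (D.m I u) ≤ I x :=
  (J_le_J_iff (hx.trans (h.plus_m u).symm)).1 ((h.isFiberMax_m u).2 x hx)

lemma differentiable (h : D.Reducible I) : Differentiable ℝ I := h.i1.1.differentiable one_ne_zero

lemma m_mem (h : D.Reducible I) (u : D.pos) : D.m I u ∈ D.M I := by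
  intro v
  have hd : HasDerivAt (fun t : ℝ => I (D.m I u + t • (v : X))) (fderiv ℝ I (D.m I u) v) 0 := by
    have h1 : HasDerivAt (fun t : ℝ => D.m I u + t • (v : X)) (v : X) 0 := by
      simpa using ((hasDerivAt_id (0 : ℝ)).smul_const (v : X)).const_add (D.m I u)
    have h2 : HasFDerivAt I (fderiv ℝ I (D.m I u)) (D.m I u + (0 : ℝ) • (v : X)) := by
      simpa using (h.differentiable (D.m I u)).hasFDerivAt
    exact h2.comp_hasDerivAt 0 h1
  refine IsLocalMin.hasDerivAt_eq_zero (Eventually.of_forall fun t => ?_) hd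
  rw [zero_smul, add_zero]
  refine h.I_m_le ?_
  rw [plus_add, plus_smul, plus_coe_neg, smul_zero, add_zero, h.plus_m]

lemma eq_m_of_le (h : D.Reducible I) {u : D.pos} {x : X} (hx : D.plus x = u)
    (hle : I x ≤ I (D.m I u)) :
    x = D.m I u := by
  by_contra hne
  have hp : D.plus (x - D.m I u) = 0 := by
    rw [sub_eq_add_neg, plus_add, plus_neg, hx, h.plus_m, add_neg_cancel]
  have e : x = D.m I u + (D.minus (x - D.m I u) : X) := by
    have := D.plus_add_minus (x - D.m I u)
    rw [hp, Submodule.coe_zero, zero_add] at this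
    rw [this]; abel
  have hne' : D.minus (x - D.m I u) ≠ 0 := fun h0 => hne (by
    rw [h0, Submodule.coe_zero, add_zero] at e; exact e)
  have := h.i5 _ (h.m_mem u) _ hne'
  rw [← e] at this
  linarith

/-- Continuity of `m`: bounded minimizing sequences converge by `I2`, `I3` and uniqueness. -/
lemma continuous_m (h : D.Reducible I) : Continuous (D.m I) := by
  refine continuous_iff_seqContinuous.2 fun u u₀ hu => tendsto_of_subseq_tendsto fun ns hns => ?_
  have hu' : Tendsto (fun n => u (ns n)) atTop (𝓝 u₀) := hu.comp hns
  -- competitors in the nearby fibres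
  let y : ℕ → X := fun n => D.m I u₀ + ((u (ns n) - u₀ : D.pos) : X)
  have hyp : ∀ n, D.plus (y n) = u (ns n) := fun n => by
    rw [plus_add, h.plus_m, plus_coe_pos]; abel
  have hy : Tendsto (fun n => I (y n)) atTop (𝓝 (I (D.m I u₀))) := by
    have h1 : Tendsto y atTop (𝓝 (D.m I u₀)) := by
      have : Tendsto (fun n => ((u (ns n) - u₀ : D.pos) : X)) atTop (𝓝 ((0 : D.pos) : X)) :=
        (continuous_subtype_val.tendsto _).comp (by simpa using hu'.sub_const u₀)
      simpa only [Submodule.coe_zero, add_zero] using this.const_add (D.m I u₀)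
    exact (h.differentiable.continuous.tendsto _).comp h1
  have hle : ∀ n, I (D.m I (u (ns n))) ≤ I (y n) := fun n => h.I_m_le (hyp n)
  obtain ⟨B₁, hB₁⟩ := hy.bddAbove_range
  obtain ⟨B₂, hB₂⟩ := hu'.norm.bddAbove_range
  obtain ⟨C, hC⟩ := h.i4.exists_bound (B₂ + B₁)
  obtain ⟨w, φ, hφ, hwu, hw⟩ := exists_tConverges_subseq h.reflexive
    (x := fun n => D.m I (u (ns n))) (u := u₀) (D := D)
    (fun n => hC _ (by
      rw [h.plus_m]
      exact add_le_add (hB₂ ⟨n, rfl⟩) ((hle n).trans (hB₁ ⟨n, rfl⟩))))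
    (by simpa only [h.plus_m] using hu')
  -- a further subsequence along which the values converge
  obtain ⟨c, -, ψ, hψ, hc⟩ := (isCompact_Icc (a := (0 : ℝ)) (b := B₁)).tendsto_subseq
    (x := fun n => I (D.m I (u (ns (φ n))))) fun n =>
      ⟨h.i1.2.2 _, (hle _).trans (hB₁ ⟨φ n, rfl⟩)⟩
  have hw' : D.TConverges (fun n => D.m I (u (ns (φ (ψ n))))) w :=
    ⟨hw.1.comp hψ.tendsto_atTop, fun f => (hw.2 f).comp hψ.tendsto_atTop⟩
  have hwc : I w ≤ c := h.i2.le_of_tendsto hw' hc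
  have hcm : c ≤ I (D.m I u₀) :=
    le_of_tendsto_of_tendsto' hc (hy.comp (hφ.tendsto_atTop.comp hψ.tendsto_atTop))
      fun n => hle _
  have hwm : w = D.m I u₀ := h.eq_m_of_le hwu (hwc.trans hcm)
  have hcw : c = I w := le_antisymm (hcm.trans (by rw [hwm])) hwc
  refine ⟨fun n => φ (ψ n), ?_⟩
  rw [← hwm]
  exact h.i3 _ w hw' (hcw ▸ hc)

lemma Jt_eq (h : D.Reducible I) (u : D.pos) : D.Jt I u = 1 / 2 * ‖u‖ ^ 2 - I (D.m I u) := by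
  rw [Jt, J, h.plus_m]

/-- The minimal value of `I` on a fibre is differentiable, with derivative `I'(m(u))`: both
inequalities come from moving a minimizer of one fibre to the other. -/
lemma hasFDerivAt_I_m (h : D.Reducible I) (u : D.pos) :
    HasFDerivAt (fun u => I (D.m I u)) ((fderiv ℝ I (D.m I u)).comp D.pos.subtypeL) u := by
  have hs : HasStrictFDerivAt I (fderiv ℝ I (D.m I u)) (D.m I u) :=
    h.i1.1.contDiffAt.hasStrictFDerivAt one_ne_zero
  rw [hasFDerivAt_iff_isLittleO, Asymptotics.isLittleO_iff]
  intro c hc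
  have hst := Asymptotics.isLittleO_iff.1 hs.isLittleO hc
  have hm : Tendsto (D.m I) (𝓝 u) (𝓝 (D.m I u)) := h.continuous_m.tendsto u
  have hsub : Tendsto (fun u' : D.pos => ((u' - u : D.pos) : X)) (𝓝 u) (𝓝 0) := by
    have : Continuous fun u' : D.pos => ((u' - u : D.pos) : X) := by fun_prop
    simpa using this.tendsto u
  have ha : Tendsto (fun u' : D.pos => (D.m I u + ((u' - u : D.pos) : X), D.m I u)) (𝓝 u)
      (𝓝 (D.m I u, D.m I u)) := by
    rw [nhds_prod_eq]
    exact (by simpa using hsub.const_add (D.m I u) :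
      Tendsto (fun u' : D.pos => D.m I u + ((u' - u : D.pos) : X)) (𝓝 u) (𝓝 (D.m I u))).prodMk
      tendsto_const_nhds
  have hb : Tendsto (fun u' : D.pos => (D.m I u', D.m I u' - ((u' - u : D.pos) : X))) (𝓝 u)
      (𝓝 (D.m I u, D.m I u)) := by
    rw [nhds_prod_eq]
    exact hm.prodMk (by simpa using hm.sub hsub)
  filter_upwards [ha.eventually hst, hb.eventually hst] with u' h1 h2
  simp only [add_sub_cancel_left, sub_sub_cancel, Real.norm_eq_abs] at h1 h2
  have h3 : I (D.m I u') ≤ I (D.m I u + ((u' - u : D.pos) : X)) := h.I_m_le (by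
    rw [plus_add, h.plus_m, plus_coe_pos]; abel)
  have h4 : I (D.m I u) ≤ I (D.m I u' - ((u' - u : D.pos) : X)) := h.I_m_le (by
    rw [sub_eq_add_neg, plus_add, plus_neg, h.plus_m, plus_coe_pos]; abel)
  rw [Real.norm_eq_abs, abs_le]
  rw [abs_le] at h1 h2
  simp only [ContinuousLinearMap.comp_apply, Submodule.subtypeL_apply]
  have hn : ‖((u' - u : D.pos) : X)‖ = ‖u' - u‖ := rfl
  rw [hn] at h1 h2
  constructor <;> linarith [h1.1, h1.2, h2.1, h2.2]

lemma hasFDerivAt_Jt (h : D.Reducible I) (u : D.pos) : HasFDerivAt (D.Jt I)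
    (D.scalarL u - (fderiv ℝ I (D.m I u)).comp D.pos.subtypeL) u := by
  have e : D.Jt I = fun u => 1 / 2 * ‖u‖ ^ 2 - I (D.m I u) := funext h.Jt_eq
  rw [e]
  exact (D.hasFDerivAt_half_norm_sq u).sub (h.hasFDerivAt_I_m u)

lemma contDiff_Jt (h : D.Reducible I) : ContDiff ℝ 1 (D.Jt I) := by
  rw [contDiff_one_iff_fderiv]
  refine ⟨fun u => (h.hasFDerivAt_Jt u).differentiableAt, ?_⟩
  have e : fderiv ℝ (D.Jt I) = fun u => D.scalarL u - (fderiv ℝ I (D.m I u)).comp D.pos.subtypeL :=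
    funext fun u => (h.hasFDerivAt_Jt u).fderiv
  rw [e]
  exact D.scalarL.continuous.sub
    (((h.i1.1.continuous_fderiv one_ne_zero).comp h.continuous_m).clm_comp continuous_const)

lemma mem_K_iff (h : D.Reducible I) (u : D.pos) : u ∈ D.K I ↔ fderiv ℝ (D.Jt I) u = 0 :=
  ⟨fun hu => hu.fderiv, fun hu => by
    have := (h.hasFDerivAt_Jt u).differentiableAt.hasFDerivAt
    rwa [hu] at this⟩

/-- A critical point `u` of `J̃` gives the critical point `m(u)` of `J`. -/
lemma hasFDerivAt_J_m (h : D.Reducible I) {u : D.pos} (hu : u ∈ D.K I) :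
    HasFDerivAt (D.J I) (0 : X →L[ℝ] ℝ) (D.m I u) := by
  have h1 : HasFDerivAt (fun x => 1 / 2 * ‖D.plus x‖ ^ 2)
      ((D.scalarL (D.plus (D.m I u))).comp D.plusL) (D.m I u) :=
    (D.hasFDerivAt_half_norm_sq (D.plus (D.m I u))).comp (D.m I u) D.plusL.hasFDerivAt
  refine (h1.sub (h.differentiable (D.m I u)).hasFDerivAt).congr_fderiv ?_
  ext x
  have h2 := ContinuousLinearMap.ext_iff.1 ((h.hasFDerivAt_Jt u).unique hu) (D.plus x)
  have h3 := h.m_mem u (D.minus x)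
  simp only [sub_apply, ContinuousLinearMap.comp_apply,
    Submodule.subtypeL_apply, zero_apply] at h2
  simp only [sub_apply, ContinuousLinearMap.comp_apply,
    zero_apply, plusL_apply, h.plus_m]
  conv_lhs => rw [← D.plus_add_minus x]
  rw [map_add, h3, add_zero, D.plus_add_minus]
  exact h2

lemma J_le_Jt (h : D.Reducible I) {u : D.pos} {x : X} (hx : D.plus x = u) : D.J I x ≤ D.Jt I u :=
  (h.isFiberMax_m u).2 x hx

lemma Jt_neg (h : D.Reducible I) (heven : ∀ x, D.J I (-x) = D.J I x) (u : D.pos) :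
    D.Jt I (-u) = D.Jt I u := by
  have aux : ∀ u : D.pos, D.Jt I u ≤ D.Jt I (-u) := fun u => by
    rw [Jt, ← heven]
    exact h.J_le_Jt (by rw [plus_neg, h.plus_m])
  exact le_antisymm (by simpa using aux (-u)) (aux u)

lemma Jt_zero (h : D.Reducible I) : D.Jt I 0 = 0 := by
  rw [h.Jt_eq]
  have h1 : I (D.m I 0) ≤ I 0 := h.I_m_le (by simpa using D.plus_coe_pos 0)
  have h2 := h.i1.2.2 (D.m I 0)
  rw [h.i1.2.1] at h1
  rw [le_antisymm h1 h2]
  simp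

/-- By `I7`, `J̃` is negative far out on every finite-dimensional subspace of `X⁺`. -/
lemma exists_Jt_neg (h : D.Reducible I) (h7 : D.I7 I) {k : ℕ} {e : Fin k → D.pos}
    (he : LinearIndependent ℝ e) (r : ℝ) :
    ∃ L > 0, ∀ c : Fin k → ℝ, (∃ i, L ≤ |c i|) →
      D.Jt I (∑ i, c i • e i) < 0 ∧ r < ‖∑ i, c i • e i‖ := by
  by_contra! hcon
  let ι : (Fin k → ℝ) → D.pos := fun c => ∑ i, c i • e i
  have hι : Continuous ι := by fun_prop
  have hιs : ∀ (t : ℝ) c, ι (t • c) = t • ι c := fun t c => by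
    simp [ι, Finset.smul_sum, mul_smul]
  choose c hc hbad using fun n : ℕ => hcon (n + 1) (by positivity)
  have hcn : ∀ n : ℕ, (n : ℝ) + 1 ≤ ‖c n‖ := fun n => by
    obtain ⟨i, hi⟩ := hc n
    exact hi.trans (norm_le_pi_norm (c n) i)
  have hpos : ∀ n, 0 < ‖c n‖ := fun n => lt_of_lt_of_le (by positivity) (hcn n)
  have ht : Tendsto (fun n => ‖c n‖) atTop atTop :=
    tendsto_atTop_mono hcn (tendsto_atTop_add_const_right _ _ tendsto_natCast_atTop_atTop)
  -- the directions converge along a subsequence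
  obtain ⟨c₀, hc₀, φ, hφ, hlim⟩ := (isCompact_sphere (0 : Fin k → ℝ) 1).tendsto_subseq
    (x := fun n => ‖c n‖⁻¹ • c n) fun n => by
      rw [mem_sphere_zero_iff_norm, norm_smul, norm_inv, norm_norm, inv_mul_cancel₀ (hpos n).ne']
  have hw : ι c₀ ≠ 0 := fun h0 => by
    have : c₀ = 0 := funext (Fintype.linearIndependent_iff.1 he c₀ h0)
    rw [this, mem_sphere_zero_iff_norm, norm_zero] at hc₀
    exact zero_ne_one hc₀
  have hplus : ∀ n, D.plus (‖c n‖⁻¹ • D.m I (ι (c n))) = ι (‖c n‖⁻¹ • c n) := fun n => by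
    rw [plus_smul, h.plus_m, hιs]
  have hdir : Tendsto (fun n => ι (‖c (φ n)‖⁻¹ • c (φ n))) atTop (𝓝 (ι c₀)) :=
    (hι.tendsto c₀).comp hlim
  have htφ := ht.comp hφ.tendsto_atTop
  have hI := h7 (fun n => ‖c (φ n)‖) (fun n => ‖c (φ n)‖⁻¹ • D.m I (ι (c (φ n)))) (ι c₀)
    htφ (by simpa only [hplus] using hdir) hw
  have hscale : ∀ n, ι (c n) = ‖c n‖ • ι (‖c n‖⁻¹ • c n) := fun n => by
    rw [← hιs, smul_smul, mul_inv_cancel₀ (hpos n).ne', one_smul]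
  have hev1 : ∀ᶠ n in atTop, D.Jt I (ι (c (φ n))) < 0 := by
    filter_upwards [hI.eventually (eventually_gt_atTop (1 / 2 * (‖ι c₀‖ + 1) ^ 2)),
      hdir.norm.eventually_lt_const (lt_add_one ‖ι c₀‖)] with n h1 h2
    have hp := hpos (φ n)
    rw [smul_smul, mul_inv_cancel₀ hp.ne', one_smul, lt_div_iff₀ (by positivity)] at h1
    rw [h.Jt_eq]
    have h3 : ‖ι (c (φ n))‖ ≤ ‖c (φ n)‖ * (‖ι c₀‖ + 1) := by
      rw [hscale, norm_smul, norm_norm]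
      gcongr
    have h4 : ‖ι (c (φ n))‖ ^ 2 ≤ (‖c (φ n)‖ * (‖ι c₀‖ + 1)) ^ 2 := by gcongr
    rw [mul_pow] at h4
    linarith
  have hev2 : ∀ᶠ n in atTop, r < ‖ι (c (φ n))‖ := by
    have h1 : Tendsto (fun n => ‖c (φ n)‖ * ‖ι (‖c (φ n)‖⁻¹ • c (φ n))‖) atTop atTop :=
      htφ.atTop_mul_pos (norm_pos_iff.2 hw) hdir.norm
    filter_upwards [h1.eventually (eventually_gt_atTop r)] with n hn
    rw [hscale, norm_smul, norm_norm]
    exact hn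
  obtain ⟨n, h1, h2⟩ := (hev1.and hev2).exists
  exact absurd h2 (not_lt.2 (hbad (φ n) h1))

end Reducible

end HilbertSplitting

/-! ### Group actions and Cerami sequences -/

namespace HilbertSplitting

variable {X : Type*} [NormedAddCommGroup X] [NormedSpace ℝ X] {D : HilbertSplitting X} {I : X → ℝ}

section Group

variable {G : Type*} [Group G] [MulAction G X]

namespace IsAdmissibleAction

lemma smul_zero_eq (hG : D.IsAdmissibleAction G I) (g : G) : g • (0 : X) = 0 := by
  have h1 := hG.pos_invariant g 0 (zero_mem _)
  have h2 := hG.neg_invariant g 0 (zero_mem _)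
  exact Submodule.disjoint_def.1 D.isCompl.disjoint _ h1 h2

lemma norm_smul_sub (hG : D.IsAdmissibleAction G I) (g : G) (x y : X) :
    ‖g • x - g • y‖ = ‖x - y‖ := by
  rw [← dist_eq_norm, ← dist_eq_norm]
  exact (hG.isometry g).dist_eq x y

/-- Isometries fixing the origin are additive, by the Mazur–Ulam theorem. -/
lemma smul_add_eq (hG : D.IsAdmissibleAction G I) (g : G) (x y : X) :
    g • (x + y) = g • x + g • y := by
  let f : X ≃ᵢ X := ⟨MulAction.toPerm g, hG.isometry g⟩
  exact (f.toRealLinearIsometryEquivOfMapZero (hG.smul_zero_eq g)).map_add x y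

/-- The action induced on `X⁺`. -/
def smulPos (hG : D.IsAdmissibleAction G I) (g : G) (u : D.pos) : D.pos :=
  ⟨g • (u : X), hG.pos_invariant g u u.2⟩

lemma plus_smul_eq (hG : D.IsAdmissibleAction G I) (g : G) (x : X) :
    D.plus (g • x) = hG.smulPos g (D.plus x) := by
  conv_lhs => rw [← D.plus_add_minus x]
  rw [hG.smul_add_eq, plus_add]
  have h1 := D.plus_coe_pos (hG.smulPos g (D.plus x))
  have h2 := D.plus_coe_neg ⟨g • (D.minus x : X), hG.neg_invariant g _ (D.minus x).2⟩
  rw [show D.plus (g • (D.plus x : X)) = _ from h1, show D.plus (g • (D.minus x : X)) = _ from h2,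
    add_zero]

lemma Jt_smulPos (hG : D.IsAdmissibleAction G I) (h : D.Reducible I) (g : G) (u : D.pos) :
    D.Jt I (hG.smulPos g u) = D.Jt I u := by
  have aux : ∀ (g : G) (u : D.pos), D.Jt I u ≤ D.Jt I (hG.smulPos g u) := fun g u => by
    rw [Jt, ← hG.invariant g]
    exact h.J_le_Jt (by rw [hG.plus_smul_eq, h.plus_m])
  refine le_antisymm ?_ (aux g u)
  have h1 := aux g⁻¹ (hG.smulPos g u)
  have e : hG.smulPos g⁻¹ (hG.smulPos g u) = u := Subtype.ext (inv_smul_smul g (u : X))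
  rwa [e] at h1

/-- Two different orbits, and two points of one orbit, stay at a positive distance: a sequence in
the orbit of `w` approaching `u` is eventually constant. -/
lemma exists_orbit_gap (hG : D.IsAdmissibleAction G I) (u w : X) :
    ∃ κ > 0, ∀ x ∈ MulAction.orbit G u, ∀ y ∈ MulAction.orbit G w, x ≠ y → κ ≤ ‖x - y‖ := by
  -- it suffices to consider `x = u`
  suffices hs : ∃ κ > 0, ∀ y ∈ MulAction.orbit G w, u ≠ y → κ ≤ ‖u - y‖ by
    obtain ⟨κ, hκ, h⟩ := hs
    refine ⟨κ, hκ, ?_⟩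
    rintro _ ⟨g, rfl⟩ y hy hne
    have h1 := h (g⁻¹ • y) (MulAction.mem_orbit_of_mem_orbit _ hy) fun he => hne (by
      simp only [he, smul_inv_smul])
    have h2 := hG.norm_smul_sub g u (g⁻¹ • y)
    rw [smul_inv_smul] at h2
    rwa [h2]
  -- distances between different points of the orbit of `w` are bounded below
  obtain ⟨ε, hε, hdist⟩ : ∃ ε > 0, ∀ y ∈ MulAction.orbit G w, ∀ z ∈ MulAction.orbit G w, y ≠ z →
      ε ≤ ‖y - z‖ := by
    by_cases hw : w = 0
    · subst hw
      refine ⟨1, one_pos, ?_⟩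
      rintro _ ⟨g, rfl⟩ _ ⟨g', rfl⟩ hne
      exact absurd (by simp only [hG.smul_zero_eq]) hne
    · obtain ⟨ε, hε, h⟩ := hG.discrete w hw
      refine ⟨ε, hε, ?_⟩
      rintro y hy _ ⟨g, rfl⟩ hne
      have h1 := h (g⁻¹ • y) (MulAction.mem_orbit_of_mem_orbit _ hy) fun he => hne (by
        simp only [← he, smul_inv_smul])
      have h2 := hG.norm_smul_sub g (g⁻¹ • y) w
      rw [smul_inv_smul] at h2
      exact h1.trans h2.ge
  -- so at most one point of the orbit of `w` other than `u` is within `ε / 2` of `u`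
  by_cases hclose : ∃ y ∈ MulAction.orbit G w, u ≠ y ∧ ‖u - y‖ < ε / 2
  · obtain ⟨y, hy, hne, hlt⟩ := hclose
    refine ⟨‖u - y‖, norm_pos_iff.2 (sub_ne_zero.2 hne), fun z hz _ => ?_⟩
    by_contra! hlt'
    have hyz : y ≠ z := fun he => by rw [he] at hlt'; exact lt_irrefl _ hlt'
    have h1 := hdist y hy z hz hyz
    have h2 := norm_sub_le_norm_sub_add_norm_sub y u z
    rw [norm_sub_rev y u] at h2
    linarith
  · push Not at hclose
    exact ⟨ε / 2, by positivity, hclose⟩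

/-- If there are finitely many critical orbits, they are represented by finitely many points. -/
lemma exists_finite_representatives (hG : D.IsAdmissibleAction G I)
    (hfin : (D.criticalOrbits G I).Finite) :
    ∃ S : Set D.pos, S.Finite ∧ S ⊆ D.K I ∧ ∀ u ∈ D.K I, ∃ s ∈ S, ∃ g : G, u = hG.smulPos g s := by
  have hch : ∀ O : Set X, ∃ u : D.pos, O ∈ D.criticalOrbits G I →
      u ∈ D.K I ∧ O = MulAction.orbit G (u : X) := fun O => by
    by_cases hO : O ∈ D.criticalOrbits G I
    · obtain ⟨u, hu⟩ := hO
      exact ⟨u, fun _ => hu⟩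
    · exact ⟨0, fun h => absurd h hO⟩
  choose ρ hρ using hch
  refine ⟨ρ '' D.criticalOrbits G I, hfin.image ρ, ?_, fun u hu => ?_⟩
  · rintro _ ⟨O, hO, rfl⟩
    exact (hρ O hO).1
  · have hO : MulAction.orbit G (u : X) ∈ D.criticalOrbits G I := ⟨u, hu, rfl⟩
    have h1 : (u : X) ∈ MulAction.orbit G (u : X) := MulAction.mem_orbit_self _
    rw [(hρ _ hO).2] at h1
    obtain ⟨g, hg⟩ := h1
    exact ⟨_, ⟨_, hO, rfl⟩, g, Subtype.ext hg.symm⟩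

end IsAdmissibleAction

end Group

lemma tendsto_smul_of_isCeramiIn {E : Type*} [NormedAddCommGroup E] [NormedSpace ℝ E] {Φ : E → ℝ}
    {β : ℝ} {u : ℕ → E} (hu : IsCeramiIn Φ β u) :
    Tendsto (fun n => (1 + ‖u n‖) • fderiv ℝ Φ (u n)) atTop (𝓝 0) := by
  refine squeeze_zero_norm (fun n => le_of_eq ?_) hu.2
  rw [norm_smul, Real.norm_of_nonneg (by positivity)]

/-- A Cerami sequence in the sense of levels `0 ≤ J̃ ≤ β` along the whole sequence. -/
lemma isCerami_of_isCeramiIn {β : ℝ} {u : ℕ → D.pos} (hu : IsCeramiIn (D.Jt I) β u) :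
    D.IsCerami I 0 β u := by
  refine ⟨le_liminf_of_le (by isBoundedDefault) (Eventually.of_forall fun n => ?_),
    limsup_le_of_le (by isBoundedDefault) (Eventually.of_forall fun n => ?_), ?_⟩
  · exact EReal.coe_le_coe_iff.2 (hu.1 n).1
  · exact EReal.coe_le_coe_iff.2 (hu.1 n).2
  · exact tendsto_smul_of_isCeramiIn hu

lemma exists_pos_le_of_finite {α : Type*} {S : Set α} (hS : S.Finite) {κ : α → ℝ}
    (hκ : ∀ x, 0 < κ x) : ∃ c > 0, ∀ x ∈ S, c ≤ κ x := by
  rcases S.eq_empty_or_nonempty with rfl | hne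
  · exact ⟨1, one_pos, by simp⟩
  · obtain ⟨x, -, hx⟩ := Set.exists_min_image S κ hS hne
    exact ⟨κ x, hκ x, hx⟩

/-- The critical points of `J̃` form infinitely many orbits. -/
lemma infinite_criticalOrbits [CompleteSpace X] (h : D.Reducible I) (h6 : D.I6 I) (h7 : D.I7 I)
    {G : Type*} [Group G] [MulAction G X] (hG : D.IsAdmissibleAction G I)
    (heven : ∀ u : X, D.J I (-u) = D.J I u) (hdim : ¬ FiniteDimensional ℝ D.pos)
    (hM : ∀ β : ℝ, 0 < β → D.ConditionM G I 0 β) : (D.criticalOrbits G I).Infinite := by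
  intro hfin
  have : CompleteSpace D.pos := D.isClosed_pos.completeSpace_coe
  obtain ⟨r, hr, a, ha, hsphere⟩ := h6
  obtain ⟨S, hS, hSK, hrep⟩ := hG.exists_finite_representatives hfin
  have hKJ : ∀ u, fderiv ℝ (D.Jt I) u = 0 → u ∈ D.K I := fun u hu => (h.mem_K_iff u).2 hu
  have hcont : Continuous (D.Jt I) := h.contDiff_Jt.continuous
  -- a common gap between the points of the finitely many orbits
  obtain ⟨κ, hκ, hgap⟩ : ∃ κ > 0, ∀ s ∈ S, ∀ s' ∈ S, ∀ x ∈ MulAction.orbit G (s : X),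
      ∀ y ∈ MulAction.orbit G (s' : X), x ≠ y → κ ≤ ‖x - y‖ := by
    choose κ hκ hgap using fun p : D.pos × D.pos => hG.exists_orbit_gap (p.1 : X) (p.2 : X)
    obtain ⟨c, hc, hcle⟩ := exists_pos_le_of_finite (hS.prod hS) hκ
    exact ⟨c, hc, fun s hs s' hs' x hx y hy hne =>
      (hcle (s, s') ⟨hs, hs'⟩).trans (hgap (s, s') x hx y hy hne)⟩
  refine false_of_finite_critical_values h.contDiff_Jt (h.Jt_neg heven) h.Jt_zero hr ha
    (fun u hu => (hsphere u hu).trans (h.J_le_Jt (D.plus_coe_pos u))) (fun k => ?_) hκ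
    ?_ ?_ ?_ ?_ ?_
  · obtain ⟨e, he⟩ := exists_linearIndependent_of_le_rank (R := ℝ) (M := D.pos)
      ((Cardinal.natCast_lt_aleph0 (n := k)).le.trans
        (not_lt.1 (mt Module.rank_lt_aleph0_iff.1 hdim)))
    exact ⟨e, h.exists_Jt_neg h7 he r⟩
  · intro w w' hw hw' hne
    obtain ⟨s, hs, g, rfl⟩ := hrep w (hKJ w hw)
    obtain ⟨s', hs', g', rfl⟩ := hrep w' (hKJ w' hw')
    exact hgap s hs s' hs' _ ⟨g, rfl⟩ _ ⟨g', rfl⟩ fun he => hne (Subtype.ext he)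
  · intro ε hε
    have hloc : ∀ s : D.pos, ∃ ρ > 0, ∀ x, ‖x - s‖ < ρ → |D.Jt I x - D.Jt I s| < ε := fun s => by
      obtain ⟨ρ, hρ, h1⟩ := Metric.continuous_iff.1 hcont s ε hε
      exact ⟨ρ, hρ, fun x hx => by simpa [Real.dist_eq] using h1 x (by rwa [dist_eq_norm])⟩
    choose ρ hρ hρJ using hloc
    obtain ⟨c, hc, hcle⟩ := exists_pos_le_of_finite hS hρ
    refine ⟨c, hc, fun w hw x hx => ?_⟩
    obtain ⟨s, hs, g, rfl⟩ := hrep w (hKJ w hw)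
    -- the estimate is transported from `s` to its orbit by the isometry `g`
    have e : x = hG.smulPos g (hG.smulPos g⁻¹ x) := Subtype.ext (smul_inv_smul g (x : X)).symm
    rw [e, hG.Jt_smulPos h g (hG.smulPos g⁻¹ x), hG.Jt_smulPos h g s]
    refine hρJ s _ (lt_of_lt_of_le ?_ (hcle s hs))
    have h1 := hG.norm_smul_sub g (g⁻¹ • (x : X)) (s : X)
    rw [smul_inv_smul] at h1
    calc ‖hG.smulPos g⁻¹ x - s‖ = ‖g⁻¹ • (x : X) - (s : X)‖ := rfl
      _ = ‖(x : X) - g • (s : X)‖ := h1.symm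
      _ < c := hx
  · refine (hS.image (D.Jt I)).subset ?_
    rintro _ ⟨w, hw, rfl⟩
    obtain ⟨s, hs, g, rfl⟩ := hrep w (hKJ w hw)
    exact ⟨s, hs, (hG.Jt_smulPos h g s).symm⟩
  · intro β hβ
    obtain ⟨C, hC⟩ := (hM β hβ).bounded
    refine ⟨C + 1, fun u hu => ?_⟩
    by_contra! hge
    have h1 := hC u (isCerami_of_isCeramiIn hu)
    have h2 : ((C + 1 : ℝ) : EReal) ≤ limsup (fun n => ((‖u n‖ : ℝ) : EReal)) atTop :=
      le_limsup_of_frequently_le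
        (Frequently.of_forall fun n => EReal.coe_le_coe_iff.2 (hge n)) (by isBoundedDefault)
    have h3 := EReal.coe_le_coe_iff.1 (h2.trans h1)
    linarith
  · intro β hβ
    obtain ⟨δ, hδ, hdisc⟩ := (hM β hβ).discrete (hfin.subset (by
      rintro O ⟨u, hu, -, -, rfl⟩
      exact ⟨u, hu, rfl⟩))
    refine ⟨δ, hδ, fun u v hu hv hlt ε hε => ?_⟩
    by_contra! hge
    have h1 := hdisc u v (isCerami_of_isCeramiIn hu) (isCerami_of_isCeramiIn hv)
      (Eventually.of_forall hlt)
    have h2 : ((ε : ℝ) : EReal) ≤ liminf (fun n => ((‖u n - v n‖ : ℝ) : EReal)) atTop :=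
      le_liminf_of_le (by isBoundedDefault)
        (Eventually.of_forall fun n => EReal.coe_le_coe_iff.2 (hge n))
    rw [h1] at h2
    have h3 : ε ≤ 0 := by exact_mod_cast h2
    linarith

end HilbertSplitting

end

theorem theorem3p2 {X : Type*} [NormedAddCommGroup X] [NormedSpace ℝ X] [CompleteSpace X]
    (hX : IsReflexiveSpace X) (D : HilbertSplitting X) (I : X → ℝ)
    (h1 : D.I1 I) (h2 : D.I2 I) (h3 : D.I3 I) (h4 : D.I4 I) (h5 : D.I5 I) (h6 : D.I6 I)
    (h7 : D.I7 I)
    {G : Type*} [Group G] [TopologicalSpace G] [IsTopologicalGroup G] [MulAction G X]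
    (hG : D.IsAdmissibleAction G I)
    (heven : ∀ u : X, D.J I (-u) = D.J I u)
    (hdim : ¬ FiniteDimensional ℝ D.pos)
    (hK : ∀ u ∈ D.K I, 0 ≤ D.Jt I u)
    (hM : ∀ β : ℝ, 0 < β → D.ConditionM G I 0 β) :
    (D.criticalOrbits G I).Infinite ∧
      {O : Set X | ∃ u : X, HasFDerivAt (D.J I) (0 : X →L[ℝ] ℝ) u ∧
        O = MulAction.orbit G u}.Infinite := by
  have h : D.Reducible I := ⟨hX, h1, h2, h3, h4, h5⟩
  have hinf := HilbertSplitting.infinite_criticalOrbits h h6 h7 hG heven hdim hM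
  refine ⟨hinf, fun hfin => hinf ?_⟩
  -- the projection to `X⁺` maps the orbit of `m(u)` onto the orbit of `u`
  refine (hfin.image fun O => (fun x => (D.plus x : X)) '' O).subset ?_
  rintro _ ⟨u, hu, rfl⟩
  refine ⟨MulAction.orbit G (D.m I u), ⟨D.m I u, h.hasFDerivAt_J_m hu, rfl⟩, ?_⟩
  have e : ∀ g : G, (D.plus (g • D.m I u) : X) = g • (u : X) := fun g => by
    rw [hG.plus_smul_eq, h.plus_m]; rfl
  ext x
  constructor
  · rintro ⟨_, ⟨g, rfl⟩, rfl⟩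
    exact ⟨g, (e g).symm⟩
  · rintro ⟨g, rfl⟩
    exact ⟨_, ⟨g, rfl⟩, e g⟩
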